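/- **Setting.** Let $n\ge m\ge 1$. For rollouts $k=1,2,\dots$ consider the linear system with multiplicative noise $$x^{(k)}_{t+1}=(A+\bar A^{(k)}_t)x^{(k)}_t+(B+\bar B^{(k)}_t)u^{(k)}_t,\qquad 0\le t\le \ell-1,$$ with $A\in\mathbb R^{n\times n}$, $B\in\mathbb R^{n\times m}$, of which the first $n_r\ge1$ rollouts are observed. $\|\cdot\|$ is the Euclidean norm, $\|\cdot\|_2$ the spectral norm, $\otimes$ the Kronecker product, $\mathrm{vec}$ stacks columns, $\dagger$ is the Moore–Penrose pseudoinverse. For $d\in\{n,m\}$ let $P_d$ be the identity matrix $I_{d^2}$ with the rows $(j-1)d+i$, $i<j$, deleted; let $Q_d$ be obtained from $I_{d^2}$ by replacing row $(j-1)d+i$ by the unit row vector with a one in position $(i-1)d+j$ for all $i<j$, and then deleting the columns $(j-1)d+i$, $i<j$. Put $P_1=P_n,Q_1=Q_n,P_2=P_m,Q_2=Q_m$. **Assumptions** (for all $k\le n_r$). (1) $\ell\ge [n(n+1)+m(m+1)]/2$. All initial states $x_0^{(k)}$, inputs $u_t^{(k)}$ and noises $\bar A_t^{(k)},\bar B_t^{(k)}$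 ($0\le t\le\ell-1$) are mutually independent with finite second moments. The $x_0^{(k)}$ are identically distributed; the $\bar A^{(k)}_t$ are identically distributed with mean zero, and so are the $\bar B^{(k)}_t$. The input $u_t^{(k)}$ has a prescribed mean $\nu_t$ and a prescribed covariance $\bar U_t\succeq0$. With $\mu_t=\mathbb E x_t$, $\tilde X_t=P_1\mathrm{vec}(\mathbb E x_tx_t^\top)$, $\tilde U_t=P_2\mathrm{vec}(\bar U_t+\nu_t\nu_t^\top)$ and $$\mathbf Z=\begin{bmatrix}\mu_{\ell-1}&\cdots&\mu_0\\ \nu_{\ell-1}&\cdots&\nu_0\end{bmatrix},\qquad \mathbf D=\begin{bmatrix}\tilde X_{\ell-1}&\cdots&\tilde X_0\\ \tilde U_{\ell-1}&\cdots&\tilde U_0\end{bmatrix},$$ the matrices $\mathbf Z\mathbf Z^\top$ and $\mathbf D\mathbf D^\top$ are invertible. (2) Almost surely $\|x_0^{(k)}\|\le c_X$, $\|u_t^{(k)}\|\le c_U$, $\|\bar A_t^{(k)}\|_2\le c_{\bar A}$, $\|\bar B_t^{(k)}\|_2\le c_{\bar B}$ for $0\le t\le\ell-1$. **Target and estimator.**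 Let $\tilde\Sigma_A'=P_1\,\mathbb E[\bar A_t\otimes\bar A_t]\,Q_1$ and $\tilde\Sigma_B'=P_1\,\mathbb E[\bar B_t\otimes\bar B_t]\,Q_2$. Let $\hat\mu_t=\frac1{n_r}\sum_k x_t^{(k)}$, $\hat{\tilde X}_t=\frac1{n_r}P_1\mathrm{vec}(\sum_k x_t^{(k)}(x_t^{(k)})^\top)$, $\hat W_t=\mathrm{vec}(\hat\mu_t\nu_t^\top)$, $\hat W_t'=\mathrm{vec}(\nu_t\hat\mu_t^\top)$; let $\hat{\mathbf Z},\hat{\mathbf D}$ be $\mathbf Z,\mathbf D$ with $\mu_t,\tilde X_t$ replaced by $\hat\mu_t,\hat{\tilde X}_t$, and $\hat{\mathbf Y}=[\hat\mu_\ell\cdots\hat\mu_1]$. Put $[\hat A\ \hat B]=\hat{\mathbf Y}\hat{\mathbf Z}^\top(\hat{\mathbf Z}\hat{\mathbf Z}^\top)^\dagger$ and $[\hat{\tilde\Sigma}_A'\ \hat{\tilde\Sigma}_B']=\hat{\mathbf C}\hat{\mathbf D}^\top(\hat{\mathbf D}\hat{\mathbf D}^\top)^\dagger$, where $\hat{\mathbf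 C}=[\hat C_\ell\cdots\hat C_1]$ and $$\hat C_t=\hat{\tilde X}_t-P_1(\hat A\otimes\hat A)Q_1\hat{\tilde X}_{t-1}-P_1(\hat B\otimes\hat A)\hat W_{t-1}-P_1(\hat A\otimes\hat B)\hat W_{t-1}'-P_1(\hat B\otimes\hat B)Q_2\tilde U_{t-1}.$$ Write $\mathrm{err}_{n_r}=\big\|[\hat{\tilde\Sigma}_A'\ \hat{\tilde\Sigma}_B']-[\tilde\Sigma_A'\ \tilde\Sigma_B']\big\|_2$. Let $\mathbf Y=[\mu_\ell\cdots\mu_1]$, and let $\mathbf C$ be $\hat{\mathbf C}$ with $\hat A,\hat B,\hat{\tilde X}_t,\hat W_t,\hat W_t'$ replaced by $A$, $B$, $\tilde X_t$, $\mathrm{vec}(\mathbb E x_tu_t^\top)$, $\mathrm{vec}(\mathbb E u_tx_t^\top)$. **Theorem.** For all $n\ge m\ge1$ and every $R$ there is $K>0$, depending only on $n,m,R$, such that the following holds for every $\ell$ and every such system whose size parameters $$\|A\|_2,\ \|B\|_2,\ c_U,\ \max_{0\le t\le\ell}\Big\{(\|A\|_2+c_{\bar A})^tc_X+\sum_{i<t}(\|A\|_2+c_{\bar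 A})^i(\|B\|_2+c_{\bar B})c_U\Big\},$$ $$\|\mathbf Y\|_2,\ \|\mathbf Z\|_2,\ \|\mathbf C\|_2,\ \|\mathbf D\|_2,\ \lambda_{\min}(\mathbf Z\mathbf Z^\top)^{-1},\ \lambda_{\min}(\mathbf D\mathbf D^\top)^{-1}$$ are all at most $R$. (i) Let $n_r\ge 1$ and suppose (1), (2) hold. For every $\delta\in(0,1)$ with $n_r\ge K\,\ell\log(\ell/\delta)$, $$\mathbb P\Big\{\mathrm{err}_{n_r}\le K\sqrt{\ell\log(\ell/\delta)/n_r}\Big\}\ge 1-\delta ;$$ and for every $\varepsilon\in(0,1/K]$, $$\mathbb P\{\mathrm{err}_{n_r}\ge\varepsilon\}\le K\,\ell\,\exp\!\Big(-\frac{n_r\varepsilon^2}{K\ell}\Big).$$ (ii) If (1), (2) hold for all $n_r$ (an infinite sequence of rollouts), then for each $\delta\in(0,1)$ there is a constant $C$, independent of $n_r$ but possibly depending on the system and on $\delta$, such that $\mathbb P\{\mathrm{err}_{n_r}\le C\sqrt{\ell\log(\ell/\delta)/n_r}\}\ge1-\delta$ for every $n_r\ge1$. -/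

import Mathlib

open MeasureTheory ProbabilityTheory Matrix
open scoped Matrix Kronecker Matrix.Norms.L2Operator

-- With `Matrix.Norms.L2Operator` open, `‖M‖` is the spectral norm of a real matrix `M`.

namespace MultNoise

/-- The entrywise (product) sigma-algebra on real matrices. -/
instance matrixMeasurableSpace {a b : Type*} : MeasurableSpace (Matrix a b ℝ) :=
  inferInstanceAs (MeasurableSpace (a → b → ℝ))

/-- Euclidean norm of a vector given by its coordinates. -/
noncomputable def euclNorm {a : Type*} [Fintype a] (v : a → ℝ) : ℝ := ‖WithLp.toLp 2 v‖

/-! ### Moore-Penrose pseudoinverse -/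

/-- The four Penrose equations: `X` is the Moore-Penrose pseudoinverse of `M`. -/
structure IsMoorePenrose {a b : Type*} [Fintype a] [Fintype b]
    (M : Matrix a b ℝ) (X : Matrix b a ℝ) : Prop where
  mul_mul_left : M * X * M = M
  mul_mul_right : X * M * X = X
  symm_left : (M * X)ᵀ = M * X
  symm_right : (X * M)ᵀ = X * M

theorem IsMoorePenrose.unique {a b : Type*} [Fintype a] [Fintype b]
    {M : Matrix a b ℝ} {X Y : Matrix b a ℝ}
    (hX : IsMoorePenrose M X) (hY : IsMoorePenrose M Y) : X = Y := by
  have h1 : M * X = M * Y := by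
    calc M * X = (M * X)ᵀ := hX.symm_left.symm
      _ = ((M * Y) * (M * X))ᵀ := by
          rw [← Matrix.mul_assoc, hY.mul_mul_left]
      _ = (M * X)ᵀ * (M * Y)ᵀ := Matrix.transpose_mul _ _
      _ = (M * X) * (M * Y) := by rw [hX.symm_left, hY.symm_left]
      _ = M * Y := by rw [← Matrix.mul_assoc, hX.mul_mul_left]
  have h2 : X * M = Y * M := by
    calc X * M = (X * M)ᵀ := hX.symm_right.symm
      _ = ((X * M) * (Y * M))ᵀ := by
          rw [Matrix.mul_assoc X M (Y * M), ← Matrix.mul_assoc M Y M, hY.mul_mul_left]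
      _ = (Y * M)ᵀ * (X * M)ᵀ := Matrix.transpose_mul _ _
      _ = (Y * M) * (X * M) := by rw [hX.symm_right, hY.symm_right]
      _ = Y * M := by
          rw [Matrix.mul_assoc Y M (X * M), ← Matrix.mul_assoc M X M, hX.mul_mul_left]
  calc X = X * M * X := hX.mul_mul_right.symm
    _ = Y * M * X := by rw [h2]
    _ = Y * (M * X) := Matrix.mul_assoc _ _ _
    _ = Y * (M * Y) := by rw [h1]
    _ = Y * M * Y := (Matrix.mul_assoc _ _ _).symm
    _ = Y := hY.mul_mul_right

open Classical in
/-- The Moore-Penrose pseudoinverse of a real matrix. -/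
noncomputable def pinv {a b : Type*} [Fintype a] [Fintype b] (M : Matrix a b ℝ) :
    Matrix b a ℝ :=
  if h : ∃ X, IsMoorePenrose M X then h.choose else 0

theorem IsMoorePenrose.eq_pinv {a b : Type*} [Fintype a] [Fintype b]
    {M : Matrix a b ℝ} {X : Matrix b a ℝ} (hX : IsMoorePenrose M X) : pinv M = X := by
  have h : ∃ X, IsMoorePenrose M X := ⟨X, hX⟩
  rw [pinv, dif_pos h]
  exact h.choose_spec.unique hX

/-- Every symmetric real matrix has a pseudoinverse, so `pinv` is genuine on Gram matrices. -/
theorem isMoorePenrose_pinv_of_symm {a : Type*} [Fintype a] [DecidableEq a]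
    {M : Matrix a a ℝ} (hM : M.IsHermitian) : IsMoorePenrose M (pinv M) := by
  obtain ⟨U, D, hU, hMD⟩ : ∃ (U : Matrix a a ℝ) (D : a → ℝ), Uᵀ * U = 1 ∧
      M = U * diagonal D * Uᵀ := by
    refine ⟨hM.eigenvectorUnitary, hM.eigenvalues, ?_, ?_⟩
    · have := (Matrix.mem_unitaryGroup_iff').1 hM.eigenvectorUnitary.2
      simpa [Matrix.star_eq_conjTranspose] using this
    · have := hM.spectral_theorem
      simpa [Unitary.conjStarAlgAut_apply, Matrix.star_eq_conjTranspose,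
        Function.comp_def] using this
  have key : ∀ d e : a → ℝ, (U * diagonal d * Uᵀ) * (U * diagonal e * Uᵀ)
      = U * diagonal (fun i => d i * e i) * Uᵀ := by
    intro d e
    rw [← diagonal_mul_diagonal]
    calc (U * diagonal d * Uᵀ) * (U * diagonal e * Uᵀ)
        = U * diagonal d * (Uᵀ * U) * (diagonal e * Uᵀ) := by simp only [Matrix.mul_assoc]
      _ = _ := by rw [hU]; simp only [Matrix.mul_assoc, Matrix.one_mul]
  have hsymm : ∀ d : a → ℝ, (U * diagonal d * Uᵀ)ᵀ = U * diagonal d * Uᵀ := by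
    intro d; simp [Matrix.mul_assoc]
  have h : IsMoorePenrose M (U * diagonal (fun i => (D i)⁻¹) * Uᵀ) := by
    subst hMD
    refine ⟨?_, ?_, ?_, ?_⟩
    · rw [key, key]; congr 3; funext i; by_cases h : D i = 0 <;> simp [h]
    · rw [key, key]; congr 3; funext i; by_cases h : D i = 0 <;> simp [h]
    · rw [key, hsymm]
    · rw [key, hsymm]
  rw [h.eq_pinv]; exact h

/-! ### Elimination and duplication matrices

The coordinate `(j - 1) n + i` of `vec M` is the entry in row `i` and column `j` of `M`; as in
`Matrix.vec`, it is indexed here by the pair `(j, i)`. The redundant coordinates of the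
vectorization of a symmetric matrix are those with `i < j`. -/

/-- Indices of the coordinates of `vec` that are kept: column index `≤` row index. -/
abbrev SymIdx (n : ℕ) : Type := {p : Fin n × Fin n // p.1 ≤ p.2}

/-- The identity matrix with the row of each redundant coordinate `(j, i)`, `i < j`, replaced by
the unit row of the coordinate `(i, j)`. -/
def foldMatrix (n : ℕ) : Matrix (Fin n × Fin n) (Fin n × Fin n) ℝ :=
  Matrix.of fun p q => if q = (if p.1 ≤ p.2 then p else p.swap) then 1 else 0

/-- The identity matrix with the redundant rows removed. -/
def elimMatrix (n : ℕ) : Matrix (SymIdx n) (Fin n × Fin n) ℝ :=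
  (1 : Matrix (Fin n × Fin n) (Fin n × Fin n) ℝ).submatrix Subtype.val id

/-- `foldMatrix` with the redundant columns removed. -/
def dupMatrix (n : ℕ) : Matrix (Fin n × Fin n) (SymIdx n) ℝ :=
  (foldMatrix n).submatrix id Subtype.val

/-! ### The system and its data -/

/-- A linear system with multiplicative noise, with nominal matrices `A`, `B`, designed input
moments `ν t` (mean) and `Ubar t` (covariance), and, for every rollout `k` and time `t`, an
initial state `x0 k`, an input `u t k` and noise matrices `Abar t k`, `Bbar t k`. -/
structure System (Ω : Type*) (n m : ℕ) where
  A : Matrix (Fin n) (Fin n) ℝ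
  B : Matrix (Fin n) (Fin m) ℝ
  ν : ℕ → Fin m → ℝ
  Ubar : ℕ → Matrix (Fin m) (Fin m) ℝ
  x0 : ℕ → Ω → Fin n → ℝ
  u : ℕ → ℕ → Ω → Fin m → ℝ
  Abar : ℕ → ℕ → Ω → Matrix (Fin n) (Fin n) ℝ
  Bbar : ℕ → ℕ → Ω → Matrix (Fin n) (Fin m) ℝ

/-- Entrywise expectation of a random matrix. -/
noncomputable def expMat {Ω a b : Type*} [MeasurableSpace Ω] (P : Measure Ω)
    (M : Ω → Matrix a b ℝ) : Matrix a b ℝ :=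
  Matrix.of fun i j => ∫ ω, M ω i j ∂P

/-- Labels of the random quantities driving the first `N` rollouts of length `ℓ`. -/
inductive Source (N ℓ : ℕ) : Type
  | start (k : Fin N)
  | input (t : Fin ℓ) (k : Fin N)
  | noiseA (t : Fin ℓ) (k : Fin N)
  | noiseB (t : Fin ℓ) (k : Fin N)

/-- The space in which each driving random quantity takes its values. -/
abbrev Source.Space (n m : ℕ) {N ℓ : ℕ} : Source N ℓ → Type
  | .start _ => Fin n → ℝ
  | .input _ _ => Fin m → ℝ
  | .noiseA _ _ => Matrix (Fin n) (Fin n) ℝ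
  | .noiseB _ _ => Matrix (Fin n) (Fin m) ℝ

instance Source.measurableSpaceSpace (n m : ℕ) {N ℓ : ℕ} :
    (s : Source N ℓ) → MeasurableSpace (s.Space n m)
  | .start _ => inferInstanceAs (MeasurableSpace (Fin n → ℝ))
  | .input _ _ => inferInstanceAs (MeasurableSpace (Fin m → ℝ))
  | .noiseA _ _ => inferInstanceAs (MeasurableSpace (Matrix (Fin n) (Fin n) ℝ))
  | .noiseB _ _ => inferInstanceAs (MeasurableSpace (Matrix (Fin n) (Fin m) ℝ))

namespace System

variable {Ω : Type*} {n m : ℕ} (S : System Ω n m)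

/-- The driving random quantity with a given label. -/
def draw {N ℓ : ℕ} : (s : Source N ℓ) → Ω → s.Space n m
  | .start k => S.x0 k
  | .input t k => S.u t k
  | .noiseA t k => S.Abar t k
  | .noiseB t k => S.Bbar t k

/-- The state of rollout `k` at time `t`. -/
def state (k : ℕ) : ℕ → Ω → Fin n → ℝ
  | 0, ω => S.x0 k ω
  | t + 1, ω => (S.A + S.Abar t k ω) *ᵥ state k t ω + (S.B + S.Bbar t k ω) *ᵥ S.u t k ω

/-! #### Exact moments

All rollouts have the same first and second moments; those of rollout `0` are used. -/

section moments

variable [MeasurableSpace Ω] (P : Measure Ω)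

/-- Mean of the state at time `t`. -/
noncomputable def mean (t : ℕ) : Fin n → ℝ := fun i => ∫ ω, S.state 0 t ω i ∂P

/-- Half-vectorized second moment of the state at time `t`. -/
noncomputable def Xtil (t : ℕ) : SymIdx n → ℝ :=
  elimMatrix n *ᵥ vec (expMat P fun ω => vecMulVec (S.state 0 t ω) (S.state 0 t ω))

/-- Half-vectorized second moment of the input at time `t`, from the designed moments. -/
noncomputable def Util (t : ℕ) : SymIdx m → ℝ :=
  elimMatrix m *ᵥ vec (S.Ubar t + vecMulVec (S.ν t) (S.ν t))

/-- Vectorized state-input second moment. -/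
noncomputable def W (t : ℕ) : Fin m × Fin n → ℝ :=
  vec (expMat P fun ω => vecMulVec (S.state 0 t ω) (S.u t 0 ω))

/-- Vectorized input-state second moment. -/
noncomputable def W' (t : ℕ) : Fin n × Fin m → ℝ :=
  vec (expMat P fun ω => vecMulVec (S.u t 0 ω) (S.state 0 t ω))

/-- The reduced covariance of the state noise. -/
noncomputable def covA : Matrix (SymIdx n) (SymIdx n) ℝ :=
  elimMatrix n * expMat P (fun ω => S.Abar 0 0 ω ⊗ₖ S.Abar 0 0 ω) * dupMatrix n

/-- The reduced covariance of the input noise. -/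
noncomputable def covB : Matrix (SymIdx n) (SymIdx m) ℝ :=
  elimMatrix n * expMat P (fun ω => S.Bbar 0 0 ω ⊗ₖ S.Bbar 0 0 ω) * dupMatrix m

end moments

/-- The part of the second-moment dynamics that is explained by a nominal pair `(A, B)`. -/
noncomputable def nominalPart (A : Matrix (Fin n) (Fin n) ℝ) (B : Matrix (Fin n) (Fin m) ℝ)
    (X : SymIdx n → ℝ) (w : Fin m × Fin n → ℝ) (w' : Fin n × Fin m → ℝ) (U : SymIdx m → ℝ) :
    SymIdx n → ℝ :=
  (elimMatrix n * (A ⊗ₖ A) * dupMatrix n) *ᵥ X + (elimMatrix n * (B ⊗ₖ A)) *ᵥ w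
    + (elimMatrix n * (A ⊗ₖ B)) *ᵥ w' + (elimMatrix n * (B ⊗ₖ B) * dupMatrix m) *ᵥ U

/-! #### Exact regression matrices

The columns run through decreasing times: column `j` belongs to time `ℓ - 1 - j` or `ℓ - j`. -/

section exact

variable [MeasurableSpace Ω] (P : Measure Ω) (ℓ : ℕ)

noncomputable def Y : Matrix (Fin n) (Fin ℓ) ℝ :=
  Matrix.of fun i j => S.mean P (j.rev + 1) i

noncomputable def Z : Matrix (Fin n ⊕ Fin m) (Fin ℓ) ℝ :=
  fromRows (Matrix.of fun i j => S.mean P j.rev i) (Matrix.of fun i j => S.ν j.rev i)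

noncomputable def C : Matrix (SymIdx n) (Fin ℓ) ℝ :=
  Matrix.of fun s j => S.Xtil P (j.rev + 1) s
    - nominalPart S.A S.B (S.Xtil P j.rev) (S.W P j.rev) (S.W' P j.rev) (S.Util j.rev) s

noncomputable def D : Matrix (SymIdx n ⊕ SymIdx m) (Fin ℓ) ℝ :=
  fromRows (Matrix.of fun s j => S.Xtil P j.rev s) (Matrix.of fun s j => S.Util j.rev s)

end exact

/-! #### The estimator, computed from the first `N` rollouts -/

section estimator

variable (ℓ N : ℕ) (ω : Ω)

noncomputable def meanHat (t : ℕ) : Fin n → ℝ :=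
  (N : ℝ)⁻¹ • ∑ k ∈ Finset.range N, S.state k t ω

noncomputable def XtilHat (t : ℕ) : SymIdx n → ℝ :=
  (N : ℝ)⁻¹ • elimMatrix n *ᵥ
    vec (∑ k ∈ Finset.range N, vecMulVec (S.state k t ω) (S.state k t ω))

noncomputable def WHat (t : ℕ) : Fin m × Fin n → ℝ :=
  vec (vecMulVec (S.meanHat N ω t) (S.ν t))

noncomputable def WHat' (t : ℕ) : Fin n × Fin m → ℝ :=
  vec (vecMulVec (S.ν t) (S.meanHat N ω t))

noncomputable def YHat : Matrix (Fin n) (Fin ℓ) ℝ :=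
  Matrix.of fun i j => S.meanHat N ω (j.rev + 1) i

noncomputable def ZHat : Matrix (Fin n ⊕ Fin m) (Fin ℓ) ℝ :=
  fromRows (Matrix.of fun i j => S.meanHat N ω j.rev i) (Matrix.of fun i j => S.ν j.rev i)

/-- Least-squares estimate of `[A B]`. -/
noncomputable def ABHat : Matrix (Fin n) (Fin n ⊕ Fin m) ℝ :=
  S.YHat ℓ N ω * (S.ZHat ℓ N ω)ᵀ * pinv (S.ZHat ℓ N ω * (S.ZHat ℓ N ω)ᵀ)

noncomputable def CHat : Matrix (SymIdx n) (Fin ℓ) ℝ :=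
  Matrix.of fun s j => S.XtilHat N ω (j.rev + 1) s
    - nominalPart (S.ABHat ℓ N ω).toCols₁ (S.ABHat ℓ N ω).toCols₂
        (S.XtilHat N ω j.rev) (S.WHat N ω j.rev) (S.WHat' N ω j.rev) (S.Util j.rev) s

noncomputable def DHat : Matrix (SymIdx n ⊕ SymIdx m) (Fin ℓ) ℝ :=
  fromRows (Matrix.of fun s j => S.XtilHat N ω j.rev s) (Matrix.of fun s j => S.Util j.rev s)

/-- Least-squares estimate of the reduced noise covariance. -/
noncomputable def covHat : Matrix (SymIdx n) (SymIdx n ⊕ SymIdx m) ℝ :=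
  S.CHat ℓ N ω * (S.DHat ℓ N ω)ᵀ * pinv (S.DHat ℓ N ω * (S.DHat ℓ N ω)ᵀ)

end estimator

section assumptions

variable [MeasurableSpace Ω] (P : Measure Ω) (ℓ N : ℕ)

/-- Spectral norm of the estimation error of the reduced noise covariance. -/
noncomputable def covError (ω : Ω) : ℝ :=
  ‖S.covHat ℓ N ω - fromCols (S.covA P) (S.covB P)‖

/-- Standing assumptions on the first `N` rollouts of length `ℓ`. -/
structure SamplingAssumptions : Prop where
  length : n * (n + 1) + m * (m + 1) ≤ 2 * ℓ
  /-- Initial states, inputs and noises, over all times and rollouts, are independent. -/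
  indep : iIndepFun (fun s : Source N ℓ => S.draw s) P
  x0_meas : ∀ k < N, Measurable (S.x0 k)
  x0_ident : ∀ k < N, IdentDistrib (S.x0 k) (S.x0 0) P P
  x0_sq : ∀ k < N, ∀ i, Integrable (fun ω => S.x0 k ω i ^ 2) P
  Abar_meas : ∀ t < ℓ, ∀ k < N, Measurable (S.Abar t k)
  Abar_ident : ∀ t < ℓ, ∀ k < N, IdentDistrib (S.Abar t k) (S.Abar 0 0) P P
  Abar_sq : ∀ t < ℓ, ∀ k < N, ∀ i j, Integrable (fun ω => S.Abar t k ω i j ^ 2) P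
  Abar_mean : ∀ t < ℓ, ∀ k < N, expMat P (S.Abar t k) = 0
  Bbar_meas : ∀ t < ℓ, ∀ k < N, Measurable (S.Bbar t k)
  Bbar_ident : ∀ t < ℓ, ∀ k < N, IdentDistrib (S.Bbar t k) (S.Bbar 0 0) P P
  Bbar_sq : ∀ t < ℓ, ∀ k < N, ∀ i j, Integrable (fun ω => S.Bbar t k ω i j ^ 2) P
  Bbar_mean : ∀ t < ℓ, ∀ k < N, expMat P (S.Bbar t k) = 0
  Ubar_psd : ∀ t < ℓ, (S.Ubar t).PosSemidef
  u_meas : ∀ t < ℓ, ∀ k < N, Measurable (S.u t k)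
  u_sq : ∀ t < ℓ, ∀ k < N, ∀ i, Integrable (fun ω => S.u t k ω i ^ 2) P
  u_mean : ∀ t < ℓ, ∀ k < N, ∀ i, ∫ ω, S.u t k ω i ∂P = S.ν t i
  u_cov : ∀ t < ℓ, ∀ k < N,
    expMat P (fun ω => vecMulVec (S.u t k ω - S.ν t) (S.u t k ω - S.ν t)) = S.Ubar t
  /-- The designed input moments are exciting. -/
  Z_inv : IsUnit (S.Z P ℓ * (S.Z P ℓ)ᵀ)
  D_inv : IsUnit (S.D P ℓ * (S.D P ℓ)ᵀ)

/-- Almost sure bounds on initial states, inputs and noises in the first `N` rollouts. -/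
structure BoundednessAssumptions (cX cU cA cB : ℝ) : Prop where
  x0_bdd : ∀ k < N, ∀ᵐ ω ∂P, euclNorm (S.x0 k ω) ≤ cX
  u_bdd : ∀ t < ℓ, ∀ k < N, ∀ᵐ ω ∂P, euclNorm (S.u t k ω) ≤ cU
  Abar_bdd : ∀ t < ℓ, ∀ k < N, ∀ᵐ ω ∂P, ‖S.Abar t k ω‖ ≤ cA
  Bbar_bdd : ∀ t < ℓ, ∀ k < N, ∀ᵐ ω ∂P, ‖S.Bbar t k ω‖ ≤ cB

/-- The radius of the set of states that can be reached within `ℓ` steps: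
the maximum over `0 ≤ t ≤ ℓ` of
`(‖A‖ + cA) ^ t * cX + ∑ i < t, (‖A‖ + cA) ^ i * (‖B‖ + cB) * cU`. -/
noncomputable def reachRadius (cX cU cA cB : ℝ) : ℝ :=
  (Finset.range (ℓ + 1)).sup' Finset.nonempty_range_add_one fun t =>
    (‖S.A‖ + cA) ^ t * cX + ∑ i ∈ Finset.range t, (‖S.A‖ + cA) ^ i * (‖S.B‖ + cB) * cU

/-- The quantities through which the coefficients of the error bound depend on the system are
at most `R`. The norms of the two inverses are the reciprocals of the smallest eigenvalues of
the Gram matrices. -/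
structure SizeAtMost (cX cU cA cB R : ℝ) : Prop where
  A_le : ‖S.A‖ ≤ R
  B_le : ‖S.B‖ ≤ R
  input_le : cU ≤ R
  reach_le : S.reachRadius ℓ cX cU cA cB ≤ R
  Y_le : ‖S.Y P ℓ‖ ≤ R
  Z_le : ‖S.Z P ℓ‖ ≤ R
  C_le : ‖S.C P ℓ‖ ≤ R
  D_le : ‖S.D P ℓ‖ ≤ R
  Z_inv_le : ‖(S.Z P ℓ * (S.Z P ℓ)ᵀ)⁻¹‖ ≤ R
  D_inv_le : ‖(S.D P ℓ * (S.D P ℓ)ᵀ)⁻¹‖ ≤ R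

end assumptions

end System

end MultNoise

/-! Both regressions are exact at the level of moments. The noise has mean zero and is independent
of the present state and input, so taking expectations in the dynamics gives `Y = [A B] Z` (`Y_eq`).
In the second-moment recursion the only trace of the noise is its covariance acting on the moments
of state and input, so `C = [ΣA ΣB] D` (`C_eq`). The Gram matrices of `Z` and `D` are invertible,
hence least squares applied to the exact moments returns the true parameters.

The estimator applies the same formulas to empirical moments, so its error is a perturbation. If
every empirical moment is within `η / √ℓ` of the exact one, the data matrices, which have `ℓ`
columns, are within `O(η)` in Frobenius norm. Products, Kronecker products and inverses are
Lipschitz near the exact data with constants depending only on `n`, `m`, `R`; two chained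
least-squares problems give an error of at most `K η` (`exists_covError_le`). This half is
deterministic.

The states are almost surely bounded and the rollouts are independent, so Hoeffding's inequality
controls each empirical moment. A union bound over `O(ℓ)` averages at accuracy `ε / √ℓ`, up to a
constant, gives the tail `K ℓ exp(-N ε² / (K ℓ))` (`measure_not_closeMoments_le`,
`exists_measure_covError_ge_le`). Choosing `ε` so that this is at most `δ` gives the confidence
bound for large `N`. For a fixed system and `δ`, only finitely many `N` remain, and each error is
bounded in probability, so a larger constant covers them. -/

namespace MultNoise

/-! ### Independent blocks of sources and concentration of averages. -/

section Independence

variable {Ω ι : Type*} {mΩ : MeasurableSpace Ω} {P : Measure Ω} {m : ι → MeasurableSpace Ω}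

/-- Functions measurable with respect to disjoint blocks of an independent family are
independent. -/
theorem indepFun_of_disjoint (hle : ∀ i, m i ≤ mΩ) (h : iIndep m P) {T₁ T₂ : Set ι}
    (hT : Disjoint T₁ T₂) {f g : Ω → ℝ} (hf : Measurable[⨆ i ∈ T₁, m i] f)
    (hg : Measurable[⨆ i ∈ T₂, m i] g) : IndepFun f g P := by
  rw [IndepFun_iff_Indep]
  exact indep_of_indep_of_le_left (indep_of_indep_of_le_right
    (indep_iSup_of_disjoint hle h hT) hg.comap_le) hf.comap_le

/-- Sums of sub-Gaussian variables measurable with respect to the successive blocks of an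
independent family are sub-Gaussian. -/
theorem hasSubgaussianMGF_sum_range_of_iIndep [IsProbabilityMeasure P] (hle : ∀ i, m i ≤ mΩ)
    (h : iIndep m P) (block : ι → ℕ) {X : ℕ → Ω → ℝ} {c : NNReal} (N : ℕ)
    (hX : ∀ k < N, Measurable[⨆ i ∈ {i | block i = k}, m i] (X k))
    (hsub : ∀ k < N, HasSubgaussianMGF (X k) c P) :
    HasSubgaussianMGF (fun ω => ∑ k ∈ Finset.range N, X k ω) (N * c) P := by
  induction N with
  | zero => simp
  | succ N ih =>
    have hN := ih (fun k hk => hX k (by omega)) (fun k hk => hsub k (by omega))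
    have hmeas : Measurable[⨆ i ∈ {i | block i < N}, m i]
        (fun ω => ∑ k ∈ Finset.range N, X k ω) := by
      refine Finset.measurable_fun_sum _ fun k hk => ?_
      refine (hX k (by simp at hk; omega)).mono ?_ le_rfl
      refine biSup_mono fun i hi => ?_
      simp at hk hi ⊢
      omega
    have hind := indepFun_of_disjoint hle h (T₁ := {i | block i < N}) (T₂ := {i | block i = N})
      (by rw [Set.disjoint_left]; intro i h1 h2; simp at h1 h2; omega) hmeas (hX N (by omega))
    have := hN.add_of_indepFun (hsub N (by omega)) hind
    simp only [Finset.sum_range_succ]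
    convert this using 1
    push_cast
    ring

/-- **Hoeffding's inequality** for the average of variables measurable with respect to the
successive blocks of an independent family. -/
theorem measure_abs_average_sub_ge_le [IsProbabilityMeasure P] (hle : ∀ i, m i ≤ mΩ)
    (h : iIndep m P) (block : ι → ℕ) {X : ℕ → Ω → ℝ} {b μ : ℝ} {N : ℕ} (hN : 1 ≤ N)
    (hX : ∀ k < N, Measurable[⨆ i ∈ {i | block i = k}, m i] (X k))
    (hb : ∀ k < N, ∀ᵐ ω ∂P, |X k ω| ≤ b) (hμ : ∀ k < N, ∫ ω, X k ω ∂P = μ)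
    {τ : ℝ} (hτ : 0 ≤ τ) :
    P.real {ω | τ ≤ |(N : ℝ)⁻¹ * ∑ k ∈ Finset.range N, X k ω - μ|}
      ≤ 2 * Real.exp (-(N * τ ^ 2 / (2 * b ^ 2))) := by
  have hN0 : (0 : ℝ) < N := by exact_mod_cast hN
  -- Hoeffding's lemma on `[-b, b]`; the variance proxy is `b ^ 2`.
  have hsub : ∀ k < N, HasSubgaussianMGF (fun ω => X k ω - μ) ((‖b - -b‖₊ / 2) ^ 2) P := by
    intro k hk
    have := hasSubgaussianMGF_of_mem_Icc (μ := P) (X := X k) (a := -b) (b := b)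
      (((hX k hk).mono (iSup₂_le fun i _ => hle i) le_rfl).aemeasurable)
      (by filter_upwards [hb k hk] with ω hω; exact abs_le.1 hω)
    rwa [hμ k hk] at this
  have hsum := hasSubgaussianMGF_sum_range_of_iIndep hle h block N
    (X := fun k ω => X k ω - μ) (fun k hk => (hX k hk).sub_const μ) hsub
  have hc : ((N * (‖b - -b‖₊ / 2) ^ 2 : NNReal) : ℝ) = N * b ^ 2 := by
    push_cast
    rw [show b - -b = 2 * b by ring, norm_mul]
    simp
  have key : ∀ Y : Ω → ℝ, HasSubgaussianMGF Y (N * (‖b - -b‖₊ / 2) ^ 2) P →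
      P.real {ω | N * τ ≤ Y ω} ≤ Real.exp (-(N * τ ^ 2 / (2 * b ^ 2))) := by
    intro Y hY
    refine (hY.measure_ge_le (ε := N * τ) (by positivity)).trans_eq ?_
    rw [hc]
    congr 1
    -- For `b = 0` both exponents are divisions by zero, hence `0`, and both sides equal `1`.
    by_cases hb0 : b = 0
    · simp [hb0]
    · field_simp
  have h1 := key _ hsum
  have h2 := key _ hsum.neg
  calc P.real {ω | τ ≤ |(N : ℝ)⁻¹ * ∑ k ∈ Finset.range N, X k ω - μ|}
      ≤ P.real ({ω | N * τ ≤ ∑ k ∈ Finset.range N, (X k ω - μ)} ∪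
          {ω | N * τ ≤ (-fun ω => ∑ k ∈ Finset.range N, (X k ω - μ)) ω}) := by
        refine measureReal_mono fun ω hω => ?_
        simp only [Set.mem_ofPred_eq, Set.mem_union, Pi.neg_apply, Finset.sum_sub_distrib,
          Finset.sum_const, Finset.card_range, nsmul_eq_mul] at hω ⊢
        set s := ∑ k ∈ Finset.range N, X k ω
        have e : s - N * μ = N * ((N : ℝ)⁻¹ * s - μ) := by field_simp
        rw [e, ← mul_neg]
        rcases le_abs.1 hω with h | h
        · left; gcongr
        · right; gcongr
    _ ≤ _ := measureReal_union_le _ _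
    _ ≤ _ := by rw [two_mul]; exact add_le_add h1 h2

/-- `f` is measurable for a given sigma-algebra and almost surely bounded. -/
def IsBddMeas (P : Measure Ω) (𝓕 : MeasurableSpace Ω) (f : Ω → ℝ) : Prop :=
  Measurable[𝓕] f ∧ ∃ c : ℝ, ∀ᵐ ω ∂P, |f ω| ≤ c

namespace IsBddMeas

variable {𝓕 𝓖 : MeasurableSpace Ω} {f g : Ω → ℝ}

theorem mono (hf : IsBddMeas P 𝓕 f) (h : 𝓕 ≤ 𝓖) : IsBddMeas P 𝓖 f :=
  ⟨hf.1.mono h le_rfl, hf.2⟩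

theorem mul (hf : IsBddMeas P 𝓕 f) (hg : IsBddMeas P 𝓕 g) :
    IsBddMeas P 𝓕 (fun ω => f ω * g ω) := by
  obtain ⟨hf, c, hc⟩ := hf
  obtain ⟨hg, d, hd⟩ := hg
  refine ⟨hf.mul hg, |c| * |d|, ?_⟩
  filter_upwards [hc, hd] with ω h1 h2
  rw [abs_mul]
  exact mul_le_mul (h1.trans (le_abs_self c)) (h2.trans (le_abs_self d)) (abs_nonneg _)
    (abs_nonneg _)

theorem const_add (hf : IsBddMeas P 𝓕 f) (a : ℝ) : IsBddMeas P 𝓕 (fun ω => a + f ω) := by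
  obtain ⟨hf, c, hc⟩ := hf
  refine ⟨hf.const_add a, |a| + c, ?_⟩
  filter_upwards [hc] with ω h
  exact (abs_add_le _ _).trans (by linarith)

theorem integrable [IsFiniteMeasure P] (hf : IsBddMeas P 𝓕 f) (hle : 𝓕 ≤ mΩ) :
    Integrable f P := by
  obtain ⟨hf, c, hc⟩ := hf
  exact Integrable.of_bound (hf.mono hle le_rfl).aestronglyMeasurable c hc

end IsBddMeas

theorem integral_mul_of_disjoint (hle : ∀ i, m i ≤ mΩ) (h : iIndep m P) {T₁ T₂ : Set ι}
    (hT : Disjoint T₁ T₂) {f g : Ω → ℝ} (hf : IsBddMeas P (⨆ i ∈ T₁, m i) f)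
    (hg : IsBddMeas P (⨆ i ∈ T₂, m i) g) :
    ∫ ω, f ω * g ω ∂P = (∫ ω, f ω ∂P) * ∫ ω, g ω ∂P :=
  (indepFun_of_disjoint hle h hT hf.1 hg.1).integral_fun_mul_eq_mul_integral
    (hf.1.mono (iSup₂_le fun i _ => hle i) le_rfl).aestronglyMeasurable
    (hg.1.mono (iSup₂_le fun i _ => hle i) le_rfl).aestronglyMeasurable

end Independence

theorem abs_le_euclNorm {a : Type*} [Fintype a] (v : a → ℝ) (i : a) : |v i| ≤ euclNorm v := by
  simpa [euclNorm] using PiLp.norm_apply_le (WithLp.toLp 2 v) i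

theorem euclNorm_nonneg {a : Type*} [Fintype a] (v : a → ℝ) : 0 ≤ euclNorm v := norm_nonneg _

theorem euclNorm_add_le {a : Type*} [Fintype a] (v w : a → ℝ) :
    euclNorm (v + w) ≤ euclNorm v + euclNorm w := by
  simpa [euclNorm] using norm_add_le (WithLp.toLp 2 v) (WithLp.toLp 2 w)

theorem euclNorm_mulVec_le {a b : Type*} [Fintype a] [Fintype b] [DecidableEq b]
    (M : Matrix a b ℝ) (v : b → ℝ) : euclNorm (M *ᵥ v) ≤ ‖M‖ * euclNorm v :=
  Matrix.l2_opNorm_mulVec M (WithLp.toLp 2 v)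

theorem abs_apply_le_l2_opNorm {a b : Type*} [Fintype a] [Fintype b] [DecidableEq b]
    (M : Matrix a b ℝ) (i : a) (j : b) : |M i j| ≤ ‖M‖ := by
  have := (abs_le_euclNorm (M *ᵥ Pi.single j 1) i).trans (euclNorm_mulVec_le M (Pi.single j 1))
  simpa [euclNorm] using this

/-! ### Which sources a state depends on. -/

namespace Source

variable {N ℓ : ℕ}

/-- The rollout that a source drives. -/
def rollout : Source N ℓ → ℕ
  | .start k => k
  | .input _ k => k
  | .noiseA _ k => k
  | .noiseB _ k => k

/-- The first time at which the state depends on a source. -/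
def stage : Source N ℓ → ℕ
  | .start _ => 0
  | .input t _ => t + 1
  | .noiseA t _ => t + 1
  | .noiseB t _ => t + 1

end Source

namespace System

variable {Ω : Type*} {n m : ℕ} (S : System Ω n m) {N ℓ : ℕ}

/-- The sigma-algebra generated by a source. -/
abbrev sourceAlg (s : Source N ℓ) : MeasurableSpace Ω :=
  MeasurableSpace.comap (S.draw s) inferInstance

theorem measurable_x0_apply (k : Fin N) (i : Fin n) :
    Measurable[S.sourceAlg (Source.start (ℓ := ℓ) k)] (fun ω => S.x0 k ω i) :=
  (measurable_pi_apply i).comp (comap_measurable (S.x0 k))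

theorem measurable_u_apply (t : Fin ℓ) (k : Fin N) (i : Fin m) :
    Measurable[S.sourceAlg (Source.input t k)] (fun ω => S.u t k ω i) :=
  (measurable_pi_apply i).comp (comap_measurable (S.u t k))

theorem measurable_Abar_apply (t : Fin ℓ) (k : Fin N) (i j : Fin n) :
    Measurable[S.sourceAlg (Source.noiseA t k)] (fun ω => S.Abar t k ω i j) :=
  (measurable_pi_apply j).comp ((measurable_pi_apply i).comp
    (comap_measurable (fun ω => (S.Abar t k ω : Fin n → Fin n → ℝ))))

theorem measurable_Bbar_apply (t : Fin ℓ) (k : Fin N) (i : Fin n) (j : Fin m) :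
    Measurable[S.sourceAlg (Source.noiseB t k)] (fun ω => S.Bbar t k ω i j) :=
  (measurable_pi_apply j).comp ((measurable_pi_apply i).comp
    (comap_measurable (fun ω => (S.Bbar t k ω : Fin n → Fin m → ℝ))))

/-- The sources of rollout `k` on which the state at time `t` depends. -/
def past (N ℓ k t : ℕ) : Set (Source N ℓ) := {s | s.rollout = k ∧ s.stage ≤ t}

theorem sourceAlg_le {T : Set (Source N ℓ)} {s : Source N ℓ} (hs : s ∈ T) :
    S.sourceAlg s ≤ ⨆ s ∈ T, S.sourceAlg s :=
  le_iSup₂_of_le s hs le_rfl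

/-- The step from `t` to `t + 1` uses only sources of stage `t + 1`. The sources of time `t` are
therefore outside `past N ℓ k t`, which is what makes them independent of the state they act on. -/
theorem measurable_state {k : ℕ} (hk : k < N) (t : ℕ) (ht : t ≤ ℓ) (i : Fin n) :
    Measurable[⨆ s ∈ past N ℓ k t, S.sourceAlg s] (fun ω => S.state k t ω i) := by
  induction t generalizing i with
  | zero =>
    exact (S.measurable_x0_apply (ℓ := ℓ) ⟨k, hk⟩ i).mono
      (S.sourceAlg_le (by simp [past, Source.rollout, Source.stage])) le_rfl
  | succ t ih =>
    have hmem : ∀ s : Source N ℓ, s.rollout = k → s.stage = t + 1 →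
        S.sourceAlg s ≤ ⨆ s ∈ past N ℓ k (t + 1), S.sourceAlg s := fun s h1 h2 =>
      S.sourceAlg_le ⟨h1, h2.le⟩
    have hpast : (⨆ s ∈ past N ℓ k t, S.sourceAlg s) ≤
        ⨆ s ∈ past N ℓ k (t + 1), S.sourceAlg s :=
      biSup_mono fun s hs => ⟨hs.1, hs.2.trans (Nat.le_succ t)⟩
    simp only [state, Pi.add_apply, mulVec, dotProduct, Matrix.add_apply]
    refine Measurable.add (Finset.measurable_fun_sum _ fun j _ => ?_)
      (Finset.measurable_fun_sum _ fun j _ => ?_)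
    · exact (((S.measurable_Abar_apply ⟨t, ht⟩ ⟨k, hk⟩ i j).mono
        (hmem _ rfl rfl) le_rfl).const_add _).mul ((ih (by omega) j).mono hpast le_rfl)
    · exact (((S.measurable_Bbar_apply ⟨t, ht⟩ ⟨k, hk⟩ i j).mono
        (hmem _ rfl rfl) le_rfl).const_add _).mul
        ((S.measurable_u_apply ⟨t, ht⟩ ⟨k, hk⟩ j).mono (hmem _ rfl rfl) le_rfl)

variable [mΩ : MeasurableSpace Ω] {P : Measure Ω} {cX cU cA cB R : ℝ}

section

variable {S}

theorem SamplingAssumptions.sourceAlg_le_ambient (h : S.SamplingAssumptions P ℓ N)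
    (s : Source N ℓ) : S.sourceAlg s ≤ mΩ := by
  refine Measurable.comap_le ?_
  cases s with
  | start k => exact h.x0_meas k k.2
  | input t k => exact h.u_meas t t.2 k k.2
  | noiseA t k => exact h.Abar_meas t t.2 k k.2
  | noiseB t k => exact h.Bbar_meas t t.2 k k.2

theorem SamplingAssumptions.iIndep_sourceAlg (h : S.SamplingAssumptions P ℓ N) :
    iIndep (fun s : Source N ℓ => S.sourceAlg s) P := h.indep

theorem SamplingAssumptions.integral_mul (h : S.SamplingAssumptions P ℓ N)
    {T₁ T₂ : Set (Source N ℓ)} (hT : Disjoint T₁ T₂) {f g : Ω → ℝ}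
    (hf : IsBddMeas P (⨆ s ∈ T₁, S.sourceAlg s) f)
    (hg : IsBddMeas P (⨆ s ∈ T₂, S.sourceAlg s) g) :
    ∫ ω, f ω * g ω ∂P = (∫ ω, f ω ∂P) * ∫ ω, g ω ∂P :=
  integral_mul_of_disjoint h.sourceAlg_le_ambient h.iIndep_sourceAlg hT hf hg

theorem SamplingAssumptions.integrable (h : S.SamplingAssumptions P ℓ N) [IsFiniteMeasure P]
    {T : Set (Source N ℓ)} {f : Ω → ℝ} (hf : IsBddMeas P (⨆ s ∈ T, S.sourceAlg s) f) :
    Integrable f P :=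
  hf.integrable (iSup₂_le fun s _ => h.sourceAlg_le_ambient s)

end

/-! ### Almost sure bounds -/

/-- The bound solves the recursion `r (t + 1) = (‖A‖ + cA) r t + (‖B‖ + cB) cU`, `r 0 = cX`, which
dominates the norm of the state. -/
theorem ae_euclNorm_state_le (hb : S.BoundednessAssumptions P ℓ N cX cU cA cB)
    {k : ℕ} (hk : k < N) (t : ℕ) (ht : t ≤ ℓ) :
    ∀ᵐ ω ∂P, euclNorm (S.state k t ω) ≤ (‖S.A‖ + cA) ^ t * cX +
      ∑ i ∈ Finset.range t, (‖S.A‖ + cA) ^ i * (‖S.B‖ + cB) * cU := by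
  induction t with
  | zero => simpa [state] using hb.x0_bdd k hk
  | succ t ih =>
    filter_upwards [ih (by omega), hb.u_bdd t ht k hk, hb.Abar_bdd t ht k hk,
      hb.Bbar_bdd t ht k hk] with ω hx hu hA hB
    have h1 : ‖S.A + S.Abar t k ω‖ ≤ ‖S.A‖ + cA := (norm_add_le _ _).trans (by gcongr)
    have h2 : ‖S.B + S.Bbar t k ω‖ ≤ ‖S.B‖ + cB := (norm_add_le _ _).trans (by gcongr)
    -- `cA` and `cB` carry no sign hypothesis; nonnegativity of the sums follows at any `ω` where
    -- the bounds hold.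
    have h1' : 0 ≤ ‖S.A‖ + cA := (norm_nonneg _).trans h1
    have h2' : 0 ≤ ‖S.B‖ + cB := (norm_nonneg _).trans h2
    calc euclNorm (S.state k (t + 1) ω)
        ≤ ‖S.A + S.Abar t k ω‖ * euclNorm (S.state k t ω)
          + ‖S.B + S.Bbar t k ω‖ * euclNorm (S.u t k ω) :=
          (euclNorm_add_le _ _).trans
            (add_le_add (euclNorm_mulVec_le _ _) (euclNorm_mulVec_le _ _))
      _ ≤ (‖S.A‖ + cA) * ((‖S.A‖ + cA) ^ t * cX +
            ∑ i ∈ Finset.range t, (‖S.A‖ + cA) ^ i * (‖S.B‖ + cB) * cU)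
          + (‖S.B‖ + cB) * cU :=
          add_le_add (mul_le_mul h1 hx (euclNorm_nonneg _) h1')
            (mul_le_mul h2 hu (euclNorm_nonneg _) h2')
      _ = _ := by
          rw [Finset.sum_range_succ', mul_add, Finset.mul_sum]
          simp only [pow_succ']
          simp [mul_assoc, add_assoc]

theorem ae_abs_state_le (hb : S.BoundednessAssumptions P ℓ N cX cU cA cB)
    (hR : S.reachRadius ℓ cX cU cA cB ≤ R) {k : ℕ} (hk : k < N) {t : ℕ} (ht : t ≤ ℓ)
    (i : Fin n) : ∀ᵐ ω ∂P, |S.state k t ω i| ≤ R := by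
  filter_upwards [S.ae_euclNorm_state_le hb hk t ht] with ω hω
  refine (abs_le_euclNorm _ i).trans (hω.trans (le_trans ?_ hR))
  exact Finset.le_sup' (fun t => (‖S.A‖ + cA) ^ t * cX +
      ∑ i ∈ Finset.range t, (‖S.A‖ + cA) ^ i * (‖S.B‖ + cB) * cU)
    (Finset.mem_range.2 (Nat.lt_succ_of_le ht))

/-! ### Moments -/

section moments

variable {S}

theorem isBddMeas_state (hb : S.BoundednessAssumptions P ℓ N cX cU cA cB)
    {k : ℕ} (hk : k < N) {t : ℕ} (ht : t ≤ ℓ) (i : Fin n) :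
    IsBddMeas P (⨆ s ∈ past N ℓ k t, S.sourceAlg s) (fun ω => S.state k t ω i) :=
  ⟨S.measurable_state hk t ht i, _,
    S.ae_abs_state_le hb (R := S.reachRadius ℓ cX cU cA cB) le_rfl hk ht i⟩

theorem isBddMeas_u (hb : S.BoundednessAssumptions P ℓ N cX cU cA cB)
    {k t : ℕ} (hk : k < N) (ht : t < ℓ) (i : Fin m) :
    IsBddMeas P (⨆ s ∈ ({.input ⟨t, ht⟩ ⟨k, hk⟩} : Set (Source N ℓ)), S.sourceAlg s)
      (fun ω => S.u t k ω i) := by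
  refine ⟨(S.measurable_u_apply ⟨t, ht⟩ ⟨k, hk⟩ i).mono (S.sourceAlg_le rfl) le_rfl, cU, ?_⟩
  filter_upwards [hb.u_bdd t ht k hk] with ω hω
  exact (abs_le_euclNorm _ i).trans hω

theorem isBddMeas_Abar (hb : S.BoundednessAssumptions P ℓ N cX cU cA cB)
    {k t : ℕ} (hk : k < N) (ht : t < ℓ) (i j : Fin n) :
    IsBddMeas P (⨆ s ∈ ({.noiseA ⟨t, ht⟩ ⟨k, hk⟩} : Set (Source N ℓ)), S.sourceAlg s)
      (fun ω => S.Abar t k ω i j) := by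
  refine ⟨(S.measurable_Abar_apply ⟨t, ht⟩ ⟨k, hk⟩ i j).mono (S.sourceAlg_le rfl) le_rfl, cA, ?_⟩
  filter_upwards [hb.Abar_bdd t ht k hk] with ω hω
  exact (abs_apply_le_l2_opNorm _ i j).trans hω

theorem isBddMeas_Bbar (hb : S.BoundednessAssumptions P ℓ N cX cU cA cB)
    {k t : ℕ} (hk : k < N) (ht : t < ℓ) (i : Fin n) (j : Fin m) :
    IsBddMeas P (⨆ s ∈ ({.noiseB ⟨t, ht⟩ ⟨k, hk⟩} : Set (Source N ℓ)), S.sourceAlg s)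
      (fun ω => S.Bbar t k ω i j) := by
  refine ⟨(S.measurable_Bbar_apply ⟨t, ht⟩ ⟨k, hk⟩ i j).mono (S.sourceAlg_le rfl) le_rfl, cB, ?_⟩
  filter_upwards [hb.Bbar_bdd t ht k hk] with ω hω
  exact (abs_apply_le_l2_opNorm _ i j).trans hω

end moments

theorem state_succ_apply {Ω : Type*} {n m : ℕ} (S : System Ω n m) (k t : ℕ) (ω : Ω) (i : Fin n) :
    S.state k (t + 1) ω i = ∑ p, (S.A i p + S.Abar t k ω i p) * S.state k t ω p +
      ∑ q, (S.B i q + S.Bbar t k ω i q) * S.u t k ω q := by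
  simp [state, mulVec, dotProduct]

section moments

theorem notMem_past_of_lt {N ℓ k t : ℕ} {s : Source N ℓ} (hs : t < s.stage) : s ∉ past N ℓ k t :=
  fun h => absurd h.2 (not_le.2 hs)

variable {Ω : Type*} {n m : ℕ} {S : System Ω n m} {N ℓ : ℕ}
variable [mΩ : MeasurableSpace Ω] {P : Measure Ω} {cX cU cA cB R : ℝ}

/-- The input at time `t` has stage `t + 1`, so it is independent of the state. This is why the
estimator can build the mixed moment from the empirical mean and the prescribed `ν`. -/
theorem integral_state_mul_u (h : S.SamplingAssumptions P ℓ N)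
    (hb : S.BoundednessAssumptions P ℓ N cX cU cA cB) {k t : ℕ} (hk : k < N) (ht : t < ℓ)
    (p : Fin n) (q : Fin m) :
    ∫ ω, S.state k t ω p * S.u t k ω q ∂P = (∫ ω, S.state k t ω p ∂P) * S.ν t q := by
  rw [h.integral_mul (Set.disjoint_singleton_right.2 (notMem_past_of_lt (by
      simp [Source.stage]))) (isBddMeas_state hb hk ht.le p) (isBddMeas_u hb hk ht q),
    h.u_mean t ht k hk]

variable [IsProbabilityMeasure P]

theorem integral_noisyA (h : S.SamplingAssumptions P ℓ N)
    (hb : S.BoundednessAssumptions P ℓ N cX cU cA cB) {k t : ℕ} (hk : k < N) (ht : t < ℓ)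
    (i p : Fin n) : ∫ ω, (S.A i p + S.Abar t k ω i p) ∂P = S.A i p := by
  have h0 : ∫ ω, S.Abar t k ω i p ∂P = 0 := congrFun (congrFun (h.Abar_mean t ht k hk) i) p
  rw [integral_add (integrable_const _) (h.integrable (isBddMeas_Abar hb hk ht i p)), h0]
  simp

theorem integral_noisyB (h : S.SamplingAssumptions P ℓ N)
    (hb : S.BoundednessAssumptions P ℓ N cX cU cA cB) {k t : ℕ} (hk : k < N) (ht : t < ℓ)
    (i : Fin n) (p : Fin m) : ∫ ω, (S.B i p + S.Bbar t k ω i p) ∂P = S.B i p := by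
  have h0 : ∫ ω, S.Bbar t k ω i p ∂P = 0 := congrFun (congrFun (h.Bbar_mean t ht k hk) i) p
  rw [integral_add (integrable_const _) (h.integrable (isBddMeas_Bbar hb hk ht i p)), h0]
  simp

theorem integral_const_add_mul_const_add {f g : Ω → ℝ} (a b : ℝ) (hf : Integrable f P)
    (hg : Integrable g P) (hfg : Integrable (fun ω => f ω * g ω) P) (hf0 : ∫ ω, f ω ∂P = 0)
    (hg0 : ∫ ω, g ω ∂P = 0) :
    ∫ ω, (a + f ω) * (b + g ω) ∂P = a * b + ∫ ω, f ω * g ω ∂P := by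
  have : ∀ ω, (a + f ω) * (b + g ω) = (a * b + a * g ω) + (b * f ω + f ω * g ω) :=
    fun ω => by ring
  simp only [this]
  rw [integral_add ((integrable_const _).fun_add (hg.const_mul a)) ((hf.const_mul b).fun_add hfg),
    integral_add (integrable_const _) (hg.const_mul a), integral_add (hf.const_mul b) hfg,
    integral_const_mul a g, integral_const_mul b f, hf0, hg0]
  simp

/-- Mean zero kills the two linear terms, and identity of distribution moves the quadratic one to
time `0` and rollout `0`. -/
theorem integral_noisyA_mul_noisyA (h : S.SamplingAssumptions P ℓ N)
    (hb : S.BoundednessAssumptions P ℓ N cX cU cA cB) {k t : ℕ} (hk : k < N) (ht : t < ℓ)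
    (i p j q : Fin n) :
    ∫ ω, (S.A i p + S.Abar t k ω i p) * (S.A j q + S.Abar t k ω j q) ∂P =
      S.A i p * S.A j q + ∫ ω, S.Abar 0 0 ω i p * S.Abar 0 0 ω j q ∂P := by
  have h1 := isBddMeas_Abar hb hk ht i p
  have h2 := isBddMeas_Abar hb hk ht j q
  rw [integral_const_add_mul_const_add _ _ (h.integrable h1) (h.integrable h2)
    (h.integrable (h1.mul h2)) (congrFun (congrFun (h.Abar_mean t ht k hk) i) p)
    (congrFun (congrFun (h.Abar_mean t ht k hk) j) q)]
  congr 1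
  have hm : ∀ i j, Measurable (fun M : Matrix (Fin n) (Fin n) ℝ => M i j) := fun i j =>
    (measurable_pi_apply j).comp (measurable_pi_apply (X := fun _ => Fin n → ℝ) i)
  exact ((h.Abar_ident t ht k hk).comp ((hm i p).mul (hm j q))).integral_eq

theorem integral_noisyB_mul_noisyB (h : S.SamplingAssumptions P ℓ N)
    (hb : S.BoundednessAssumptions P ℓ N cX cU cA cB) {k t : ℕ} (hk : k < N) (ht : t < ℓ)
    (i : Fin n) (p : Fin m) (j : Fin n) (q : Fin m) :
    ∫ ω, (S.B i p + S.Bbar t k ω i p) * (S.B j q + S.Bbar t k ω j q) ∂P =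
      S.B i p * S.B j q + ∫ ω, S.Bbar 0 0 ω i p * S.Bbar 0 0 ω j q ∂P := by
  have h1 := isBddMeas_Bbar hb hk ht i p
  have h2 := isBddMeas_Bbar hb hk ht j q
  rw [integral_const_add_mul_const_add _ _ (h.integrable h1) (h.integrable h2)
    (h.integrable (h1.mul h2)) (congrFun (congrFun (h.Bbar_mean t ht k hk) i) p)
    (congrFun (congrFun (h.Bbar_mean t ht k hk) j) q)]
  congr 1
  have hm : ∀ i j, Measurable (fun M : Matrix (Fin n) (Fin m) ℝ => M i j) := fun i j =>
    (measurable_pi_apply j).comp (measurable_pi_apply (X := fun _ => Fin m → ℝ) i)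
  exact ((h.Bbar_ident t ht k hk).comp ((hm i p).mul (hm j q))).integral_eq

theorem integral_u_mul_u (h : S.SamplingAssumptions P ℓ N)
    (hb : S.BoundednessAssumptions P ℓ N cX cU cA cB) {k t : ℕ} (hk : k < N) (ht : t < ℓ)
    (p q : Fin m) :
    ∫ ω, S.u t k ω p * S.u t k ω q ∂P = (S.Ubar t + vecMulVec (S.ν t) (S.ν t)) p q := by
  have h1 := isBddMeas_u hb hk ht p
  have h2 := isBddMeas_u hb hk ht q
  have hc : ∫ ω, (S.u t k ω p - S.ν t p) * (S.u t k ω q - S.ν t q) ∂P = S.Ubar t p q :=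
    congrFun (congrFun (h.u_cov t ht k hk) p) q
  have i1 : Integrable (fun ω => S.u t k ω p - S.ν t p) P :=
    (h.integrable h1).sub (integrable_const _)
  have i2 : Integrable (fun ω => S.u t k ω q - S.ν t q) P :=
    (h.integrable h2).sub (integrable_const _)
  have h1' := h1.const_add (-S.ν t p)
  have h2' := h2.const_add (-S.ν t q)
  have := integral_const_add_mul_const_add (S.ν t p) (S.ν t q) i1 i2
    (by simpa [neg_add_eq_sub] using h.integrable (h1'.mul h2'))
    (by rw [integral_sub (h.integrable h1) (integrable_const _), h.u_mean t ht k hk]; simp)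
    (by rw [integral_sub (h.integrable h2) (integrable_const _), h.u_mean t ht k hk]; simp)
  rw [hc] at this
  simpa [vecMulVec_apply, add_comm] using this

theorem integral_state_succ (h : S.SamplingAssumptions P ℓ N)
    (hb : S.BoundednessAssumptions P ℓ N cX cU cA cB) {k t : ℕ} (hk : k < N) (ht : t < ℓ)
    (i : Fin n) :
    ∫ ω, S.state k (t + 1) ω i ∂P =
      ∑ p, S.A i p * ∫ ω, S.state k t ω p ∂P + ∑ q, S.B i q * S.ν t q := by
  have hall : ∀ T : Set (Source N ℓ), (⨆ s ∈ T, S.sourceAlg s) ≤ ⨆ s ∈ Set.univ, S.sourceAlg s :=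
    fun T => biSup_mono fun s _ => Set.mem_univ s
  have ha := fun p => (isBddMeas_Abar hb hk ht i p).const_add (S.A i p)
  have hB := fun q => (isBddMeas_Bbar hb hk ht i q).const_add (S.B i q)
  have hx := fun p => isBddMeas_state hb hk ht.le p
  have hu := fun q => isBddMeas_u hb hk ht q
  have i1 := fun p => h.integrable (((ha p).mono (hall _)).mul ((hx p).mono (hall _)))
  have i2 := fun q => h.integrable (((hB q).mono (hall _)).mul ((hu q).mono (hall _)))
  simp only [state_succ_apply]
  rw [integral_add (integrable_finsetSum _ fun p _ => i1 p)
    (integrable_finsetSum _ fun q _ => i2 q), integral_finsetSum _ fun p _ => i1 p,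
    integral_finsetSum _ fun q _ => i2 q]
  congr 1
  · refine Finset.sum_congr rfl fun p _ => ?_
    rw [h.integral_mul (Set.disjoint_singleton_left.2 (notMem_past_of_lt (by
      simp [Source.stage]))) (ha p) (hx p), integral_noisyA h hb hk ht]
  · refine Finset.sum_congr rfl fun q _ => ?_
    rw [h.integral_mul (by simp) (hB q) (hu q), integral_noisyB h hb hk ht, h.u_mean t ht k hk]

/-- Expanding the product gives four double sums. In the state-state and input-input sums the same
noise occurs twice and leaves its second moment. In the two mixed sums both noises, the state and
the input are independent, so only the nominal matrices survive. -/
theorem integral_state_succ_mul_state_succ (h : S.SamplingAssumptions P ℓ N)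
    (hb : S.BoundednessAssumptions P ℓ N cX cU cA cB) {k t : ℕ} (hk : k < N) (ht : t < ℓ)
    (i j : Fin n) :
    ∫ ω, S.state k (t + 1) ω i * S.state k (t + 1) ω j ∂P =
      ∑ p, ∑ q, (S.A i p * S.A j q + ∫ ω, S.Abar 0 0 ω i p * S.Abar 0 0 ω j q ∂P) *
          ∫ ω, S.state k t ω p * S.state k t ω q ∂P
      + ∑ p, ∑ q, S.A i p * S.B j q * ((∫ ω, S.state k t ω p ∂P) * S.ν t q)
      + ∑ p, ∑ q, S.B i p * S.A j q * ((∫ ω, S.state k t ω q ∂P) * S.ν t p)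
      + ∑ p, ∑ q, (S.B i p * S.B j q + ∫ ω, S.Bbar 0 0 ω i p * S.Bbar 0 0 ω j q ∂P) *
          (S.Ubar t + vecMulVec (S.ν t) (S.ν t)) p q := by
  have hall : ∀ T : Set (Source N ℓ), (⨆ s ∈ T, S.sourceAlg s) ≤ ⨆ s ∈ Set.univ, S.sourceAlg s :=
    fun T => biSup_mono fun s _ => Set.mem_univ s
  have ha := fun i p => (isBddMeas_Abar hb hk ht i p).const_add (S.A i p)
  have hB := fun i q => (isBddMeas_Bbar hb hk ht i q).const_add (S.B i q)
  have hx := fun p => isBddMeas_state hb hk ht.le p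
  have hu := fun q => isBddMeas_u hb hk ht q
  have hax := fun i p => ((ha i p).mono (hall _)).mul ((hx p).mono (hall _))
  have hbu := fun i q => ((hB i q).mono (hall _)).mul ((hu q).mono (hall _))
  -- The factors are split off one at a time: the noise on `A`, then the noise on `B`, then the
  -- input from the state.
  have cross : ∀ i j p q, ∫ ω, ((S.A i p + S.Abar t k ω i p) * S.state k t ω p) *
      ((S.B j q + S.Bbar t k ω j q) * S.u t k ω q) ∂P =
      S.A i p * S.B j q * ((∫ ω, S.state k t ω p ∂P) * S.ν t q) := by
    intro i j p q
    have e : ∀ ω, ((S.A i p + S.Abar t k ω i p) * S.state k t ω p) *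
      ((S.B j q + S.Bbar t k ω j q) * S.u t k ω q) =
      (S.A i p + S.Abar t k ω i p) * ((S.B j q + S.Bbar t k ω j q) *
        (S.state k t ω p * S.u t k ω q)) := fun ω => by ring
    have hxu : IsBddMeas P (⨆ s ∈ past N ℓ k t ∪ {.input ⟨t, ht⟩ ⟨k, hk⟩}, S.sourceAlg s)
        (fun ω => S.state k t ω p * S.u t k ω q) :=
      ((hx p).mono (biSup_mono fun s hs => Or.inl hs)).mul
        ((hu q).mono (biSup_mono fun s hs => Or.inr hs))
    have hbxu : IsBddMeas P (⨆ s ∈ {.noiseB ⟨t, ht⟩ ⟨k, hk⟩} ∪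
          (past N ℓ k t ∪ {.input ⟨t, ht⟩ ⟨k, hk⟩}), S.sourceAlg s)
        (fun ω => (S.B j q + S.Bbar t k ω j q) * (S.state k t ω p * S.u t k ω q)) :=
      ((hB j q).mono (biSup_mono fun s hs => Or.inl hs)).mul
        (hxu.mono (biSup_mono fun s hs => Or.inr hs))
    simp only [e]
    rw [h.integral_mul (by
        rw [Set.disjoint_singleton_left]
        rintro (h | h | h)
        · cases h
        · exact notMem_past_of_lt (by simp [Source.stage]) h
        · cases h) (ha i p) hbxu,
      h.integral_mul (by
        rw [Set.disjoint_singleton_left]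
        rintro (h | h)
        · exact notMem_past_of_lt (by simp [Source.stage]) h
        · cases h) (hB j q) hxu, integral_noisyA h hb hk ht, integral_noisyB h hb hk ht,
      integral_state_mul_u h hb hk ht, mul_assoc]
  have e : ∀ ω, S.state k (t + 1) ω i * S.state k (t + 1) ω j =
      ∑ p, ∑ q, ((S.A i p + S.Abar t k ω i p) * S.state k t ω p) *
        ((S.A j q + S.Abar t k ω j q) * S.state k t ω q)
      + ∑ p, ∑ q, ((S.A i p + S.Abar t k ω i p) * S.state k t ω p) *
        ((S.B j q + S.Bbar t k ω j q) * S.u t k ω q)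
      + ∑ p, ∑ q, ((S.B i p + S.Bbar t k ω i p) * S.u t k ω p) *
        ((S.A j q + S.Abar t k ω j q) * S.state k t ω q)
      + ∑ p, ∑ q, ((S.B i p + S.Bbar t k ω i p) * S.u t k ω p) *
        ((S.B j q + S.Bbar t k ω j q) * S.u t k ω q) := by
    intro ω
    simp only [state_succ_apply, ← Finset.sum_mul_sum]
    ring
  have I : ∀ {α β : Type} [Fintype α] [Fintype β] {f : α → Ω → ℝ} {g : β → Ω → ℝ},
      (∀ p, IsBddMeas P (⨆ s ∈ Set.univ, S.sourceAlg (N := N) (ℓ := ℓ) s) (f p)) →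
      (∀ q, IsBddMeas P (⨆ s ∈ Set.univ, S.sourceAlg (N := N) (ℓ := ℓ) s) (g q)) →
      Integrable (fun ω => ∑ p, ∑ q, f p ω * g q ω) P ∧
      ∫ ω, ∑ p, ∑ q, f p ω * g q ω ∂P = ∑ p, ∑ q, ∫ ω, f p ω * g q ω ∂P := by
    intro α β _ _ f g hf hg
    have i0 := fun p q => h.integrable ((hf p).mul (hg q))
    refine ⟨integrable_finsetSum _ fun p _ => integrable_finsetSum _ fun q _ => i0 p q, ?_⟩
    rw [integral_finsetSum _ fun p _ => integrable_finsetSum _ fun q _ => i0 p q]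
    exact Finset.sum_congr rfl fun p _ => integral_finsetSum _ fun q _ => i0 p q
  obtain ⟨i1, e1⟩ := I (hax i) (hax j)
  obtain ⟨i2, e2⟩ := I (hax i) (hbu j)
  obtain ⟨i3, e3⟩ := I (hbu i) (hax j)
  obtain ⟨i4, e4⟩ := I (hbu i) (hbu j)
  simp only [e]
  rw [integral_add ((i1.fun_add i2).fun_add i3) i4, integral_add (i1.fun_add i2) i3, integral_add i1 i2,
    e1, e2, e3, e4]
  congr 1; congr 1; congr 1
  · refine Finset.sum_congr rfl fun p _ => Finset.sum_congr rfl fun q _ => ?_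
    simp only [mul_mul_mul_comm _ (S.state k t _ p)]
    rw [h.integral_mul (Set.disjoint_singleton_left.2 (notMem_past_of_lt (by
      simp [Source.stage]))) ((ha i p).mul (ha j q)) ((hx p).mul (hx q)),
      integral_noisyA_mul_noisyA h hb hk ht]
  · exact Finset.sum_congr rfl fun p _ => Finset.sum_congr rfl fun q _ => cross i j p q
  · refine Finset.sum_congr rfl fun p _ => Finset.sum_congr rfl fun q _ => ?_
    rw [← mul_comm (S.A j q), ← cross j i q p]
    simp only [mul_comm]
  · refine Finset.sum_congr rfl fun p _ => Finset.sum_congr rfl fun q _ => ?_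
    simp only [mul_mul_mul_comm _ (S.u t k _ p)]
    rw [h.integral_mul (by simp) ((hB i p).mul (hB j q)) ((hu p).mul (hu q)),
      integral_noisyB_mul_noisyB h hb hk ht, integral_u_mul_u h hb hk ht]

/-- Inputs of different rollouts share only their first two moments, so the states need not be
identically distributed. Their means agree because they obey the same recursion from the same
initial value; the second moments below agree likewise. -/
theorem integral_state_eq_mean (h : S.SamplingAssumptions P ℓ N)
    (hb : S.BoundednessAssumptions P ℓ N cX cU cA cB) {k : ℕ} (hk : k < N) (t : ℕ) (ht : t ≤ ℓ)
    (i : Fin n) : ∫ ω, S.state k t ω i ∂P = S.mean P t i := by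
  induction t generalizing i with
  | zero => exact ((h.x0_ident k hk).comp (measurable_pi_apply i)).integral_eq
  | succ t ih =>
    rw [mean, integral_state_succ h hb hk ht, integral_state_succ h hb (by omega) ht]
    simp only [ih (by omega), mean]

/-- Second moment of the state at time `t`. -/
noncomputable def secondMoment (S : System Ω n m) (P : Measure Ω) (t : ℕ) :
    Matrix (Fin n) (Fin n) ℝ :=
  expMat P fun ω => vecMulVec (S.state 0 t ω) (S.state 0 t ω)

theorem integral_state_mul_state_eq (h : S.SamplingAssumptions P ℓ N)
    (hb : S.BoundednessAssumptions P ℓ N cX cU cA cB) {k : ℕ} (hk : k < N) (t : ℕ) (ht : t ≤ ℓ)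
    (i j : Fin n) : ∫ ω, S.state k t ω i * S.state k t ω j ∂P = S.secondMoment P t i j := by
  induction t generalizing i j with
  | zero =>
    exact ((h.x0_ident k hk).comp
      ((measurable_pi_apply i).mul (measurable_pi_apply j))).integral_eq
  | succ t ih =>
    change _ = ∫ ω, S.state 0 (t + 1) ω i * S.state 0 (t + 1) ω j ∂P
    rw [integral_state_succ_mul_state_succ h hb hk ht,
      integral_state_succ_mul_state_succ h hb (by omega) ht]
    simp only [ih (by omega), integral_state_eq_mean h hb hk t (by omega), mean]
    rfl

end moments

end System

/-! ### Half-vectorization and the exact regression identities. -/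

theorem elimMatrix_mulVec {n : ℕ} (v : Fin n × Fin n → ℝ) :
    elimMatrix n *ᵥ v = fun s => v s.1 := by
  ext s
  simp [elimMatrix, mulVec, dotProduct, Matrix.one_apply]

theorem elimMatrix_mul_apply {n : ℕ} {b : Type*} (M : Matrix (Fin n × Fin n) b ℝ) (s : SymIdx n)
    (j : b) : (elimMatrix n * M) s j = M s.1 j := by
  simp [elimMatrix, Matrix.mul_apply, Matrix.one_apply]

/-- Row `p` of `dupMatrix` has its only one at whichever of `p`, `p.swap` is kept, and by symmetry
both carry the same entry. -/
theorem dupMatrix_mulVec_elimMatrix_mulVec {n : ℕ} {M : Matrix (Fin n) (Fin n) ℝ}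
    (hM : ∀ i j, M i j = M j i) : dupMatrix n *ᵥ (elimMatrix n *ᵥ vec M) = vec M := by
  ext p
  obtain ⟨q, hq⟩ : ∃ q : SymIdx n, q.1 = (if p.1 ≤ p.2 then p else p.swap) := by
    refine ⟨⟨if p.1 ≤ p.2 then p else p.swap, ?_⟩, rfl⟩
    split_ifs with h
    · exact h
    · exact (not_le.1 h).le
  have h1 : ∀ s : SymIdx n, dupMatrix n p s = if s = q then 1 else 0 := by
    intro s
    simp only [dupMatrix, foldMatrix, Matrix.submatrix_apply, Matrix.of_apply, id, ← hq,
      Subtype.ext_iff]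
  rw [elimMatrix_mulVec]
  simp only [mulVec, dotProduct, h1, ite_mul, one_mul, zero_mul, Finset.sum_ite_eq', Finset.mem_univ, if_true, hq]
  split_ifs with h
  · rfl
  · exact hM _ _

namespace System

variable {Ω : Type*} {n m : ℕ} {S : System Ω n m} {N ℓ : ℕ}

/-- No information is lost on symmetric matrices: the reduced operator acts as the full one. The
index `(q, p)` is column first, as in `vec`. -/
theorem reduced_mulVec {K : Matrix (Fin n × Fin n) (Fin m × Fin m) ℝ} {M : Matrix (Fin m) (Fin m) ℝ}
    (hM : ∀ i j, M i j = M j i) (s : SymIdx n) :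
    ((elimMatrix n * K * dupMatrix m) *ᵥ (elimMatrix m *ᵥ vec M)) s =
      ∑ p, ∑ q, K s.1 (q, p) * M p q := by
  rw [← mulVec_mulVec, dupMatrix_mulVec_elimMatrix_mulVec hM, mulVec, dotProduct,
    Fintype.sum_prod_type, Finset.sum_comm]
  simp [elimMatrix_mul_apply, vec]

variable [MeasurableSpace Ω] {P : Measure Ω} {cX cU cA cB R : ℝ}

theorem secondMoment_symm (t : ℕ) (i j : Fin n) :
    S.secondMoment P t i j = S.secondMoment P t j i := by
  simp [secondMoment, expMat, vecMulVec_apply, mul_comm]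

theorem inputMoment_symm (h : S.SamplingAssumptions P ℓ N) {t : ℕ} (ht : t < ℓ) (i j : Fin m) :
    (S.Ubar t + vecMulVec (S.ν t) (S.ν t)) i j = (S.Ubar t + vecMulVec (S.ν t) (S.ν t)) j i := by
  have := congrFun (congrFun (h.Ubar_psd t ht).isHermitian i) j
  simp only [conjTranspose_apply, star_trivial] at this
  simp [vecMulVec_apply, mul_comm, this]

theorem W_apply (h : S.SamplingAssumptions P ℓ N)
    (hb : S.BoundednessAssumptions P ℓ N cX cU cA cB) (hN : 1 ≤ N) {t : ℕ} (ht : t < ℓ)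
    (q : Fin m) (p : Fin n) : S.W P t (q, p) = S.mean P t p * S.ν t q :=
  integral_state_mul_u h hb hN ht p q

theorem W'_apply (h : S.SamplingAssumptions P ℓ N)
    (hb : S.BoundednessAssumptions P ℓ N cX cU cA cB) (hN : 1 ≤ N) {t : ℕ} (ht : t < ℓ)
    (p : Fin n) (q : Fin m) : S.W' P t (p, q) = S.mean P t p * S.ν t q := by
  rw [← W_apply h hb hN ht]
  simp [W, W', vec, expMat, vecMulVec_apply, mul_comm]

variable [IsProbabilityMeasure P]

/-- Removing the nominal part from the second-moment recursion leaves exactly the two noise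
covariances applied to the moments of state and input. -/
theorem C_eq (h : S.SamplingAssumptions P ℓ N)
    (hb : S.BoundednessAssumptions P ℓ N cX cU cA cB) (hN : 1 ≤ N) :
    S.C P ℓ = fromCols (S.covA P) (S.covB P) * S.D P ℓ := by
  ext s j
  obtain ⟨t, ht, ht'⟩ : ∃ t < ℓ, (j.rev : ℕ) = t := ⟨_, j.rev.2, rfl⟩
  have hR : (fromCols (S.covA P) (S.covB P) * S.D P ℓ) s j =
      (S.covA P *ᵥ S.Xtil P t) s + (S.covB P *ᵥ S.Util t) s := by
    simp [D, Matrix.mul_apply, mulVec, dotProduct, ht', -Fin.val_rev]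
  rw [hR]
  simp only [C, Matrix.of_apply, ht', nominalPart, Pi.add_apply, covA, covB]
  have hX : S.Xtil P t = elimMatrix n *ᵥ vec (S.secondMoment P t) := rfl
  rw [hX, Util, reduced_mulVec (secondMoment_symm t), reduced_mulVec (secondMoment_symm t),
    reduced_mulVec (inputMoment_symm h ht), reduced_mulVec (inputMoment_symm h ht)]
  have hX' : S.Xtil P (t + 1) s = S.secondMoment P (t + 1) s.1.2 s.1.1 := by
    rw [Xtil, elimMatrix_mulVec]; rfl
  rw [hX', ← integral_state_mul_state_eq h hb hN (t + 1) ht,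
    integral_state_succ_mul_state_succ h hb hN ht]
  simp only [integral_state_mul_state_eq h hb hN t ht.le, integral_state_eq_mean h hb hN t ht.le]
  simp only [mulVec, dotProduct, Fintype.sum_prod_type, elimMatrix_mul_apply, kroneckerMap_apply,
    W_apply h hb hN ht, W'_apply h hb hN ht, expMat, Matrix.of_apply, add_mul,
    Finset.sum_add_distrib]
  -- The moment recursion lists factors in the order row, column, while `vec` indexes column first;
  -- sums and factors are commuted to match.
  rw [Finset.sum_comm (f := fun x y => S.B s.1.1 x * S.A s.1.2 y * (S.mean P t y * S.ν t x)),
    Finset.sum_comm (f := fun x y => S.A s.1.1 x * S.B s.1.2 y * (S.mean P t x * S.ν t y))]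
  simp only [fun p q => mul_comm (S.A s.1.1 p) (S.A s.1.2 q),
    fun p q => mul_comm (S.B s.1.1 p) (S.A s.1.2 q), fun p q => mul_comm (S.A s.1.1 p) (S.B s.1.2 q),
    fun p q => mul_comm (S.B s.1.1 p) (S.B s.1.2 q),
    fun ω p q => mul_comm (S.Abar 0 0 ω s.1.1 p) (S.Abar 0 0 ω s.1.2 q),
    fun ω p q => mul_comm (S.Bbar 0 0 ω s.1.1 p) (S.Bbar 0 0 ω s.1.2 q)]
  ring

theorem Y_eq (h : S.SamplingAssumptions P ℓ N)
    (hb : S.BoundednessAssumptions P ℓ N cX cU cA cB) (hN : 1 ≤ N) :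
    S.Y P ℓ = fromCols S.A S.B * S.Z P ℓ := by
  ext i j
  have ht : (j.rev : ℕ) < ℓ := j.rev.2
  have := integral_state_succ h hb hN ht i
  simp only [integral_state_eq_mean h hb hN _ ht.le,
    integral_state_eq_mean h hb hN _ (Nat.succ_le_of_lt ht)] at this
  simpa [Y, Z, Matrix.mul_apply] using this

end System

/-! ### The Frobenius norm and its comparison with the spectral norm. -/

section Frobenius

variable {a b c d : Type*} [Fintype a] [Fintype b] [Fintype c] [Fintype d]

/-- Frobenius norm of a real matrix. -/
noncomputable def fro (M : Matrix a b ℝ) : ℝ :=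
  -- The instance is explicit because `‖·‖` denotes the spectral norm here.
  @norm _ (Matrix.frobeniusNormedAddCommGroup (α := ℝ)).toNorm M

theorem fro_eq_sqrt (M : Matrix a b ℝ) : fro M = Real.sqrt (∑ i, ∑ j, M i j ^ 2) := by
  rw [fro, Matrix.frobenius_norm_def, Real.sqrt_eq_rpow]
  simp

theorem fro_nonneg (M : Matrix a b ℝ) : 0 ≤ fro M :=
  @norm_nonneg _ (Matrix.frobeniusSeminormedAddCommGroup (α := ℝ)).toSeminormedAddGroup M

theorem fro_sq (M : Matrix a b ℝ) : fro M ^ 2 = ∑ i, ∑ j, M i j ^ 2 := by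
  rw [fro_eq_sqrt]
  exact Real.sq_sqrt (Finset.sum_nonneg fun i _ => Finset.sum_nonneg fun j _ => sq_nonneg _)

theorem fro_add_le (M M' : Matrix a b ℝ) : fro (M + M') ≤ fro M + fro M' :=
  @norm_add_le _ (Matrix.frobeniusSeminormedAddCommGroup (α := ℝ)).toSeminormedAddGroup M M'

theorem fro_neg (M : Matrix a b ℝ) : fro (-M) = fro M :=
  @norm_neg _ (Matrix.frobeniusSeminormedAddCommGroup (α := ℝ)).toSeminormedAddGroup M

theorem fro_zero : fro (0 : Matrix a b ℝ) = 0 :=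
  @norm_zero _ (Matrix.frobeniusSeminormedAddCommGroup (α := ℝ)).toSeminormedAddGroup

theorem fro_transpose (M : Matrix a b ℝ) : fro Mᵀ = fro M := Matrix.frobenius_norm_transpose M

theorem fro_mul_le (M : Matrix a b ℝ) (M' : Matrix b c ℝ) : fro (M * M') ≤ fro M * fro M' :=
  Matrix.frobenius_norm_mul M M'

theorem fro_kronecker (M : Matrix a b ℝ) (M' : Matrix c d ℝ) : fro (M ⊗ₖ M') = fro M * fro M' := by
  rw [← Real.sqrt_sq (fro_nonneg (M ⊗ₖ M')), ← Real.sqrt_sq (mul_nonneg (fro_nonneg M)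
    (fro_nonneg M')), mul_pow, fro_sq, fro_sq, fro_sq]
  congr 1
  simp only [Fintype.sum_prod_type, kroneckerMap_apply, mul_pow, Finset.sum_mul_sum]

theorem fro_submatrix_le (M : Matrix a b ℝ) {f : c → a} {g : d → b} (hf : f.Injective)
    (hg : g.Injective) : fro (M.submatrix f g) ≤ fro M := by
  rw [fro_eq_sqrt, fro_eq_sqrt]
  refine Real.sqrt_le_sqrt ?_
  calc ∑ i, ∑ j, M.submatrix f g i j ^ 2
      ≤ ∑ i, ∑ j, M (f i) j ^ 2 := Finset.sum_le_sum fun i _ => by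
        simpa using Finset.sum_le_sum_of_subset_of_nonneg (f := fun j => M (f i) j ^ 2)
          (Finset.subset_univ (Finset.univ.map ⟨g, hg⟩)) fun _ _ _ => sq_nonneg _
    _ ≤ ∑ i, ∑ j, M i j ^ 2 := by
        simpa using Finset.sum_le_sum_of_subset_of_nonneg (f := fun i => ∑ j, M i j ^ 2)
          (Finset.subset_univ (Finset.univ.map ⟨f, hf⟩)) fun _ _ _ =>
            Finset.sum_nonneg fun _ _ => sq_nonneg _

theorem fro_le_of_forall_abs_le {M : Matrix a b ℝ} {τ : ℝ} (hτ : 0 ≤ τ)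
    (h : ∀ i j, |M i j| ≤ τ) :
    fro M ≤ Real.sqrt (Fintype.card a) * (Real.sqrt (Fintype.card b) * τ) := by
  rw [fro_eq_sqrt, ← mul_assoc, ← Real.sqrt_mul (Nat.cast_nonneg _)]
  refine Real.sqrt_le_iff.2 ⟨by positivity, ?_⟩
  rw [mul_pow, Real.sq_sqrt (by positivity)]
  calc ∑ i, ∑ j, M i j ^ 2 ≤ ∑ _i : a, ∑ _j : b, τ ^ 2 :=
        Finset.sum_le_sum fun i _ => Finset.sum_le_sum fun j _ => by
          rw [← sq_abs]
          exact pow_le_pow_left₀ (abs_nonneg _) (h i j) 2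
    _ = _ := by simp [mul_assoc]

theorem euclNorm_sq (v : a → ℝ) : euclNorm v ^ 2 = ∑ i, v i ^ 2 := by
  simp [euclNorm, EuclideanSpace.norm_sq_eq]

theorem l2_opNorm_le_fro [DecidableEq b] (M : Matrix a b ℝ) : ‖M‖ ≤ fro M := by
  rw [Matrix.l2_opNorm_def]
  refine ContinuousLinearMap.opNorm_le_bound _ (fro_nonneg M) fun v => ?_
  change euclNorm (M *ᵥ v.ofLp) ≤ fro M * ‖v‖
  rw [show ‖v‖ = euclNorm v.ofLp from rfl]
  refine le_of_sq_le_sq ?_ (mul_nonneg (fro_nonneg M) (euclNorm_nonneg _))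
  rw [mul_pow, euclNorm_sq, euclNorm_sq, fro_sq, Finset.sum_mul]
  exact Finset.sum_le_sum fun i _ => Finset.sum_mul_sq_le_sq_mul_sq _ _ _

/-- Each row is the image of a unit vector under `Mᵀ`. The factor counts rows, not columns, so for
the data matrices it is free of `ℓ`. -/
theorem fro_le_sqrt_card_mul_l2_opNorm [DecidableEq a] [DecidableEq b] (M : Matrix a b ℝ) :
    fro M ≤ Real.sqrt (Fintype.card a) * ‖M‖ := by
  refine le_of_sq_le_sq ?_ (by positivity)
  rw [fro_sq, mul_pow, Real.sq_sqrt (Nat.cast_nonneg _)]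
  calc ∑ i, ∑ j, M i j ^ 2 ≤ ∑ _i : a, ‖M‖ ^ 2 := Finset.sum_le_sum fun i _ => by
        have h1 := euclNorm_mulVec_le Mᵀ (Pi.single i 1)
        have h2 : ‖Mᵀ‖ = ‖M‖ := by
          simpa [conjTranspose_eq_transpose_of_trivial] using Matrix.l2_opNorm_conjTranspose M
        have h3 : euclNorm (Pi.single i 1 : a → ℝ) = 1 := by simp [euclNorm]
        rw [h2, h3, mul_one] at h1
        have h4 := pow_le_pow_left₀ (euclNorm_nonneg _) h1 2
        rw [euclNorm_sq] at h4
        simpa using h4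
    _ = _ := by simp

end Frobenius

/-! ### First-order perturbations -/

/-- `M'` is within `c η` of `M`, which has size at most `c`. -/
structure Near {a b : Type*} [Fintype a] [Fintype b] (η c : ℝ) (M' M : Matrix a b ℝ) : Prop where
  size : fro M ≤ c
  dist : fro (M' - M) ≤ c * η

namespace Near

variable {a b c d : Type*} [Fintype a] [Fintype b] [Fintype c] [Fintype d]
  {η x y : ℝ} {M M' : Matrix a b ℝ}

theorem nonneg (h : Near η x M' M) : 0 ≤ x := (fro_nonneg M).trans h.size

theorem const (hη : 0 ≤ η) (h : fro M ≤ x) : Near η x M M :=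
  ⟨h, by simpa [fro_zero] using mul_nonneg ((fro_nonneg M).trans h) hη⟩

theorem mono (hη : 0 ≤ η) (h : Near η x M' M) (hxy : x ≤ y) : Near η y M' M :=
  ⟨h.size.trans hxy, h.dist.trans (by gcongr)⟩

theorem add {L L' : Matrix a b ℝ} (h : Near η x M' M) (h' : Near η y L' L) :
    Near η (x + y) (M' + L') (M + L) := by
  refine ⟨(fro_add_le _ _).trans (add_le_add h.size h'.size), ?_⟩
  rw [add_sub_add_comm, add_mul]
  exact (fro_add_le _ _).trans (add_le_add h.dist h'.dist)

theorem neg (h : Near η x M' M) : Near η x (-M') (-M) :=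
  ⟨by rw [fro_neg]; exact h.size, by rw [← neg_sub', fro_neg]; exact h.dist⟩

theorem sub {L L' : Matrix a b ℝ} (h : Near η x M' M) (h' : Near η y L' L) :
    Near η (x + y) (M' - L') (M - L) := by
  simpa only [sub_eq_add_neg] using h.add h'.neg

theorem transpose (h : Near η x M' M) : Near η x M'ᵀ Mᵀ :=
  ⟨by rw [fro_transpose]; exact h.size, by
    rw [← transpose_sub, fro_transpose]; exact h.dist⟩

theorem submatrix (h : Near η x M' M) {f : c → a} {g : d → b} (hf : f.Injective)
    (hg : g.Injective) : Near η x (M'.submatrix f g) (M.submatrix f g) :=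
  ⟨(fro_submatrix_le M hf hg).trans h.size, (fro_submatrix_le (M' - M) hf hg).trans h.dist⟩

theorem size_left (hη1 : η ≤ 1) (h : Near η x M' M) : fro M' ≤ 2 * x := by
  calc fro M' = fro ((M' - M) + M) := by rw [sub_add_cancel]
    _ ≤ x * η + x := (fro_add_le _ _).trans (add_le_add h.dist h.size)
    _ ≤ 2 * x := by nlinarith [h.nonneg]

/-- Telescoping `M' L' - M L = (M' - M) L' + M (L' - L)`; since `η ≤ 1`, `L'` has size at most `2
y`, whence `3 = 2 + 1`. -/
theorem mul (hη : 0 ≤ η) (hη1 : η ≤ 1) {L L' : Matrix b c ℝ} (h : Near η x M' M)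
    (h' : Near η y L' L) : Near η (3 * (x * y)) (M' * L') (M * L) := by
  have hx := h.nonneg
  have hy := h'.nonneg
  have hL := h'.size_left hη1
  constructor
  · calc fro (M * L) ≤ x * y := (fro_mul_le _ _).trans
          (mul_le_mul h.size h'.size (fro_nonneg _) hx)
      _ ≤ _ := by nlinarith [mul_nonneg hx hy]
  · calc fro (M' * L' - M * L) = fro ((M' - M) * L' + M * (L' - L)) := by
          congr 1; rw [Matrix.sub_mul, Matrix.mul_sub]; abel
      _ ≤ (x * η) * (2 * y) + x * (y * η) := (fro_add_le _ _).trans (add_le_add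
          ((fro_mul_le _ _).trans (mul_le_mul h.dist hL (fro_nonneg _) (by positivity)))
          ((fro_mul_le _ _).trans (mul_le_mul h.size h'.dist (fro_nonneg _) hx)))
      _ = _ := by ring

theorem kronecker (hη1 : η ≤ 1) {L L' : Matrix c d ℝ} (h : Near η x M' M)
    (h' : Near η y L' L) : Near η (3 * (x * y)) (M' ⊗ₖ L') (M ⊗ₖ L) := by
  have hx := h.nonneg
  have hy := h'.nonneg
  have hL := h'.size_left hη1
  constructor
  · calc fro (M ⊗ₖ L) ≤ x * y := (fro_kronecker _ _).le.trans
          (mul_le_mul h.size h'.size (fro_nonneg _) hx)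
      _ ≤ _ := by nlinarith [mul_nonneg hx hy]
  · calc fro (M' ⊗ₖ L' - M ⊗ₖ L) = fro ((M' - M) ⊗ₖ L' + M ⊗ₖ (L' - L)) := by
          congr 1
          ext i j
          simp only [Matrix.sub_apply, Matrix.add_apply, kroneckerMap_apply]
          ring
      _ ≤ (x * η) * (2 * y) + x * (y * η) := by
          refine (fro_add_le _ _).trans (add_le_add ?_ ?_)
          · rw [fro_kronecker]
            exact mul_le_mul h.dist hL (fro_nonneg _) ((fro_nonneg _).trans h.dist)
          · rw [fro_kronecker]
            exact mul_le_mul h.size h'.dist (fro_nonneg _) hx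
      _ = _ := by ring

end Near

/-! ### Perturbation of inverses and of least squares. -/

theorem pinv_eq_inv {a : Type*} [Fintype a] [DecidableEq a] {M : Matrix a a ℝ} (hM : IsUnit M) :
    pinv M = M⁻¹ := by
  have hd := (Matrix.isUnit_iff_isUnit_det M).1 hM
  refine IsMoorePenrose.eq_pinv ⟨?_, ?_, ?_, ?_⟩ <;>
    simp [Matrix.mul_nonsing_inv _ hd, Matrix.nonsing_inv_mul _ hd]

/-- Neumann series: `M' = M (1 + M⁻¹ (M' - M))` with a correction of norm at most `1 / 2`. -/
theorem isUnit_of_fro_sub_le {a : Type*} [Fintype a] [DecidableEq a] {M M' : Matrix a a ℝ}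
    (hM : IsUnit M) (h : fro M⁻¹ * fro (M' - M) ≤ 1 / 2) : IsUnit M' := by
  have hd := (Matrix.isUnit_iff_isUnit_det M).1 hM
  have : CompleteSpace (Matrix a a ℝ) := FiniteDimensional.complete ℝ _
  have h1 : ‖-(M⁻¹ * (M' - M))‖ < 1 := by
    rw [norm_neg]
    linarith [l2_opNorm_le_fro (M⁻¹ * (M' - M)), fro_mul_le M⁻¹ (M' - M)]
  have h2 := hM.mul (isUnit_one_sub_of_norm_lt_one h1)
  convert h2 using 1
  rw [sub_neg_eq_add, Matrix.mul_add, ← Matrix.mul_assoc, Matrix.mul_nonsing_inv _ hd]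
  simp

theorem Near.pinv {a : Type*} [Fintype a] [DecidableEq a] {M M' : Matrix a a ℝ} {η x y : ℝ}
    (hη : 0 ≤ η) (h : Near η x M' M) (hM : IsUnit M) (hy : fro M⁻¹ ≤ y)
    (hxy : y * (x * η) ≤ 1 / 2) : Near η (y + 2 * x * y ^ 2) (pinv M') M⁻¹ := by
  have hx := h.nonneg
  have hy0 : 0 ≤ y := (fro_nonneg _).trans hy
  have hM' : IsUnit M' := isUnit_of_fro_sub_le hM
    ((mul_le_mul hy h.dist (fro_nonneg _) hy0).trans hxy)
  have hd := (Matrix.isUnit_iff_isUnit_det M).1 hM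
  have hd' := (Matrix.isUnit_iff_isUnit_det M').1 hM'
  rw [pinv_eq_inv hM']
  -- The resolvent identity.
  have e : M'⁻¹ - M⁻¹ = -(M'⁻¹ * ((M' - M) * M⁻¹)) := by
    rw [Matrix.sub_mul, Matrix.mul_sub, ← Matrix.mul_assoc, Matrix.nonsing_inv_mul _ hd',
      Matrix.mul_nonsing_inv _ hd]
    simp
  have h1 : fro (M'⁻¹ - M⁻¹) ≤ fro M'⁻¹ * (x * η * y) := by
    rw [e, fro_neg]
    refine (fro_mul_le _ _).trans (mul_le_mul_of_nonneg_left ?_ (fro_nonneg _))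
    exact (fro_mul_le _ _).trans (mul_le_mul h.dist hy (fro_nonneg _) (by positivity))
  -- Self-bounding: `x η y ≤ 1 / 2` turns `h1` into `fro M'⁻¹ ≤ fro M'⁻¹ / 2 + y`.
  have h2 : fro M'⁻¹ ≤ 2 * y := by
    have : fro M'⁻¹ ≤ fro (M'⁻¹ - M⁻¹) + fro M⁻¹ := by
      simpa using fro_add_le (M'⁻¹ - M⁻¹) M⁻¹
    nlinarith [fro_nonneg M'⁻¹]
  refine ⟨hy.trans (le_add_of_nonneg_right (by positivity)), h1.trans ?_⟩
  calc fro M'⁻¹ * (x * η * y) ≤ 2 * y * (x * η * y) := by gcongr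
    _ ≤ (y + 2 * x * y ^ 2) * η := by nlinarith [mul_nonneg hy0 hη]

universe v

/-- Least squares is Lipschitz near data with an invertible Gram matrix. -/
theorem exists_near_leastSquares (a b : Type*) [Fintype a] [Fintype b] [DecidableEq b]
    (x y r : ℝ) : ∃ K : ℝ, 1 ≤ K ∧ ∀ (ℓ : ℕ) (η : ℝ) (Y' Y : Matrix a (Fin ℓ) ℝ)
      (Z' Z : Matrix b (Fin ℓ) ℝ), 0 ≤ η → η ≤ K⁻¹ → Near η x Y' Y → Near η y Z' Z →
      IsUnit (Z * Zᵀ) → fro (Z * Zᵀ)⁻¹ ≤ r →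
      Near η K (Y' * Z'ᵀ * pinv (Z' * Z'ᵀ)) (Y * Zᵀ * (Z * Zᵀ)⁻¹) := by
  -- `g` is the `Near` constant of the Gram matrix and `c` that of the whole formula. Including `2 r
  -- g` in `K` ensures `r (g η) ≤ 1 / 2`, as `Near.pinv` requires.
  set g := 3 * (y * y) with hg
  set c := 3 * (3 * (x * y) * (r + 2 * g * r ^ 2)) with hc
  refine ⟨max 1 (max c (2 * (r * g))), le_max_left _ _, ?_⟩
  intro ℓ η Y' Y Z' Z hη hηK hY hZ hU hr
  set K := max 1 (max c (2 * (r * g)))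
  have hK : 1 ≤ K := le_max_left _ _
  have hη1 : η ≤ 1 := hηK.trans (inv_le_one_of_one_le₀ hK)
  have hKη : K * η ≤ 1 := by
    calc K * η ≤ K * K⁻¹ := by gcongr
      _ = 1 := mul_inv_cancel₀ (by positivity)
  have hG := hZ.mul hη hη1 hZ.transpose
  have hP := hG.pinv hη hU hr (by
    have : 2 * (r * g) ≤ K := (le_max_right _ _).trans (le_max_right _ _)
    nlinarith [mul_le_mul_of_nonneg_right this hη])
  exact ((hY.mul hη hη1 hZ.transpose).mul hη hη1 hP).mono hη
    ((le_max_left _ _).trans (le_max_right _ _))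

theorem mul_transpose_mul_inv_of_eq {a b : Type*} [Fintype a] [Fintype b] [DecidableEq b]
    {ℓ : ℕ} {Y : Matrix a (Fin ℓ) ℝ} {Z : Matrix b (Fin ℓ) ℝ} {M : Matrix a b ℝ} (h : Y = M * Z)
    (hU : IsUnit (Z * Zᵀ)) : Y * Zᵀ * (Z * Zᵀ)⁻¹ = M := by
  rw [h, Matrix.mul_assoc M, Matrix.mul_assoc M,
    Matrix.mul_nonsing_inv _ ((Matrix.isUnit_iff_isUnit_det _).1 hU), Matrix.mul_one]

/-- The map `nominalPart`, applied to all columns of matrices. -/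
noncomputable def nominalMat {n m ℓ : ℕ} (A : Matrix (Fin n) (Fin n) ℝ)
    (B : Matrix (Fin n) (Fin m) ℝ) (X : Matrix (SymIdx n) (Fin ℓ) ℝ)
    (w : Matrix (Fin m × Fin n) (Fin ℓ) ℝ) (w' : Matrix (Fin n × Fin m) (Fin ℓ) ℝ)
    (U : Matrix (SymIdx m) (Fin ℓ) ℝ) : Matrix (SymIdx n) (Fin ℓ) ℝ :=
  elimMatrix n * (A ⊗ₖ A) * dupMatrix n * X + elimMatrix n * (B ⊗ₖ A) * w
    + elimMatrix n * (A ⊗ₖ B) * w' + elimMatrix n * (B ⊗ₖ B) * dupMatrix m * U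

theorem exists_near_nominalMat (n m : ℕ) (x y z : ℝ) : ∃ c : ℝ, ∀ (ℓ : ℕ) (η : ℝ)
      (A' A : Matrix (Fin n) (Fin n) ℝ) (B' B : Matrix (Fin n) (Fin m) ℝ)
      (X' X : Matrix (SymIdx n) (Fin ℓ) ℝ) (w' w : Matrix (Fin m × Fin n) (Fin ℓ) ℝ)
      (v' v : Matrix (Fin n × Fin m) (Fin ℓ) ℝ) (U' U : Matrix (SymIdx m) (Fin ℓ) ℝ),
      0 ≤ η → η ≤ 1 → Near η x A' A → Near η x B' B → Near η y X' X → Near η z w' w →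
      Near η z v' v → Near η y U' U →
      Near η c (nominalMat A' B' X' w' v' U') (nominalMat A B X w v U) := by
  -- The constant stays open and is read off from the composed `Near` lemmas; introduced before `ℓ`
  -- and the data, it cannot depend on them.
  apply Exists.intro
  intro ℓ η A' A B' B X' X w' w v' v U' U hη hη1 hA hB hX hw hv hU
  have hE := Near.const hη (le_refl (fro (elimMatrix n)))
  have hQn := Near.const hη (le_refl (fro (dupMatrix n)))
  have hQm := Near.const hη (le_refl (fro (dupMatrix m)))
  exact (((((hE.mul hη hη1 (hA.kronecker hη1 hA)).mul hη hη1 hQn).mul hη hη1 hX).add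
    ((hE.mul hη hη1 (hB.kronecker hη1 hA)).mul hη hη1 hw)).add
    ((hE.mul hη hη1 (hA.kronecker hη1 hB)).mul hη hη1 hv)).add
    (((hE.mul hη hη1 (hB.kronecker hη1 hB)).mul hη hη1 hQm).mul hη hη1 hU)

/-- Entrywise closeness of matrices with `ℓ` columns. -/
theorem Near.of_entries {a : Type*} [Fintype a] [DecidableEq a] {ℓ : ℕ} (hℓ : 0 < ℓ) {η R : ℝ}
    (hη : 0 ≤ η) {M' M : Matrix a (Fin ℓ) ℝ} (hM : ‖M‖ ≤ R)
    (h : ∀ i j, |M' i j - M i j| ≤ η / Real.sqrt ℓ) :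
    Near η (Real.sqrt (Fintype.card a) * (R + 1)) M' M := by
  have hR : 0 ≤ R := (norm_nonneg _).trans hM
  have hℓ' : 0 < Real.sqrt ℓ := Real.sqrt_pos.2 (by exact_mod_cast hℓ)
  constructor
  · refine (fro_le_sqrt_card_mul_l2_opNorm M).trans (mul_le_mul_of_nonneg_left ?_ (by positivity))
    linarith
  · refine (fro_le_of_forall_abs_le (M := M' - M) (by positivity) h).trans ?_
    -- The `√ℓ` from the number of columns cancels the entrywise `1 / √ℓ`.
    rw [Fintype.card_fin, mul_div_cancel₀ _ hℓ'.ne', mul_assoc]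
    gcongr
    nlinarith

/-! ### From close moments to a close estimate. -/

namespace System

/-- Matrix with the columns `WHat t`, in the order of `C`. -/
noncomputable def WHatMat {Ω : Type*} {n m : ℕ} (S : System Ω n m) (ℓ N : ℕ) (ω : Ω) :
    Matrix (Fin m × Fin n) (Fin ℓ) ℝ :=
  Matrix.of fun s j => S.WHat N ω j.rev s

/-- Matrix with the columns `XtilHat (t + 1)`, in the order of `C`. -/
noncomputable def XNextHat {Ω : Type*} {n m : ℕ} (S : System Ω n m) (ℓ N : ℕ) (ω : Ω) :
    Matrix (SymIdx n) (Fin ℓ) ℝ :=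
  Matrix.of fun s j => S.XtilHat N ω (j.rev + 1) s

theorem CHat_eq_sub {Ω : Type*} {n m : ℕ} (S : System Ω n m) {ℓ N : ℕ} (ω : Ω) :
    S.CHat ℓ N ω = S.XNextHat ℓ N ω - nominalMat (S.ABHat ℓ N ω).toCols₁ (S.ABHat ℓ N ω).toCols₂
      (S.DHat ℓ N ω).toRows₁ (S.WHatMat ℓ N ω)
      ((S.WHatMat ℓ N ω).submatrix Prod.swap id) (S.DHat ℓ N ω).toRows₂ := by
  have hW : ∀ j : Fin ℓ, S.WHat' N ω j.rev = fun s => S.WHat N ω j.rev s.swap := fun j => by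
    ext ⟨p, q⟩
    simp [WHat, WHat', vec, vecMulVec_apply, mul_comm]
  ext s j
  simp only [CHat, Matrix.of_apply, hW]
  rfl

variable {Ω : Type*} {n m : ℕ} {S : System Ω n m} {N ℓ : ℕ}
variable [MeasurableSpace Ω] {P : Measure Ω} {cX cU cA cB R : ℝ}

/-- Matrix with the columns `W t`, in the order of `C`. -/
noncomputable def WMat (S : System Ω n m) (P : Measure Ω) (ℓ : ℕ) :
    Matrix (Fin m × Fin n) (Fin ℓ) ℝ :=
  Matrix.of fun s j => S.W P j.rev s

/-- Matrix with the columns `Xtil (t + 1)`, in the order of `C`. -/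
noncomputable def XNext (S : System Ω n m) (P : Measure Ω) (ℓ : ℕ) :
    Matrix (SymIdx n) (Fin ℓ) ℝ :=
  Matrix.of fun s j => S.Xtil P (j.rev + 1) s

theorem C_eq_sub (h : S.SamplingAssumptions P ℓ N)
    (hb : S.BoundednessAssumptions P ℓ N cX cU cA cB) (hN : 1 ≤ N) :
    S.C P ℓ = S.XNext P ℓ - nominalMat S.A S.B (S.D P ℓ).toRows₁ (S.WMat P ℓ)
      ((S.WMat P ℓ).submatrix Prod.swap id) (S.D P ℓ).toRows₂ := by
  have hW : ∀ j : Fin ℓ, S.W' P j.rev = fun s => S.W P j.rev s.swap := fun j => by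
    ext ⟨p, q⟩
    rw [W'_apply h hb hN j.rev.2, Prod.swap_prod_mk, W_apply h hb hN j.rev.2]
  ext s j
  simp only [C, Matrix.of_apply, hW]
  rfl

variable [IsProbabilityMeasure P]

/-- All averages over the first `N` rollouts are within `τ` of the exact moments. -/
structure CloseMoments (S : System Ω n m) (P : Measure Ω) (ℓ N : ℕ) (τ : ℝ) (ω : Ω) : Prop where
  mean : ∀ t ≤ ℓ, ∀ i, |S.meanHat N ω t i - S.mean P t i| ≤ τ
  second : ∀ t ≤ ℓ, ∀ s, |S.XtilHat N ω t s - S.Xtil P t s| ≤ τ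

theorem abs_ν_le (h : S.SamplingAssumptions P ℓ N)
    (hb : S.BoundednessAssumptions P ℓ N cX cU cA cB) (hN : 1 ≤ N) {t : ℕ} (ht : t < ℓ)
    (q : Fin m) : |S.ν t q| ≤ cU := by
  rw [← h.u_mean t ht 0 hN q]
  have hle : ∀ᵐ ω ∂P, ‖S.u t 0 ω q‖ ≤ cU := by
    filter_upwards [hb.u_bdd t ht 0 hN] with ω hω
    exact (abs_le_euclNorm _ q).trans hω
  simpa using norm_integral_le_of_norm_le_const hle

/-- The entries of `W` are products of `μ` and `ν` with `|ν| ≤ R`, so each of its `m` blocks is at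
most `R` times the state part of `Z`. This gives a size bound free of `ℓ`, the first summand; the
second bounds the distance. -/
theorem near_WHatMat (h : S.SamplingAssumptions P ℓ N)
    (hb : S.BoundednessAssumptions P ℓ N cX cU cA cB) (hN : 1 ≤ N) (hℓ : 0 < ℓ)
    (hR : S.SizeAtMost P ℓ cX cU cA cB R) {η : ℝ} (hη : 0 ≤ η) {ω : Ω}
    (hω : S.CloseMoments P ℓ N (η / Real.sqrt ℓ) ω) :
    Near η (Real.sqrt m * R * (Real.sqrt (n + m) * (R + 1)) + Real.sqrt (m * n) * R)
      (S.WHatMat ℓ N ω) (S.WMat P ℓ) := by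
  have hR0 : 0 ≤ R := (norm_nonneg _).trans hR.A_le
  have hℓ' : 0 < Real.sqrt ℓ := Real.sqrt_pos.2 (by exact_mod_cast hℓ)
  have hν : ∀ (j : Fin ℓ) q, |S.ν j.rev q| ≤ R := fun j q =>
    (abs_ν_le h hb hN j.rev.2 q).trans hR.input_le
  have hW : ∀ q p j, S.WMat P ℓ (q, p) j = S.mean P j.rev p * S.ν j.rev q := fun q p j =>
    W_apply h hb hN j.rev.2 q p
  have hZ : fro (S.Z P ℓ) ≤ Real.sqrt (n + m) * (R + 1) := by
    refine (fro_le_sqrt_card_mul_l2_opNorm _).trans ?_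
    simp only [Fintype.card_sum, Fintype.card_fin, Nat.cast_add]
    gcongr
    linarith [hR.Z_le]
  constructor
  · refine le_add_of_le_of_nonneg ?_ (by positivity)
    refine le_of_sq_le_sq ?_ (by positivity)
    rw [mul_pow, mul_pow, Real.sq_sqrt (by positivity)]
    calc fro (S.WMat P ℓ) ^ 2
        = ∑ q, ∑ p, ∑ j : Fin ℓ, (S.mean P j.rev p * S.ν j.rev q) ^ 2 := by
          rw [fro_sq, Fintype.sum_prod_type]
          simp only [hW]
      _ ≤ ∑ _q : Fin m, R ^ 2 * fro (S.Z P ℓ) ^ 2 := by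
          refine Finset.sum_le_sum fun q _ => ?_
          have h1 : ∑ p, ∑ j : Fin ℓ, (S.mean P j.rev p) ^ 2 ≤ fro (S.Z P ℓ) ^ 2 := by
            rw [fro_sq, Fintype.sum_sum_type]
            refine le_add_of_le_of_nonneg (le_of_eq rfl) ?_
            exact Finset.sum_nonneg fun _ _ => Finset.sum_nonneg fun _ _ => sq_nonneg _
          refine le_trans ?_ (mul_le_mul_of_nonneg_left h1 (sq_nonneg R))
          simp only [Finset.mul_sum]
          refine Finset.sum_le_sum fun p _ => Finset.sum_le_sum fun j _ => ?_
          rw [mul_pow, mul_comm]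
          refine mul_le_mul_of_nonneg_right ?_ (sq_nonneg _)
          rw [← sq_abs]
          exact pow_le_pow_left₀ (abs_nonneg _) (hν j q) 2
      _ = m * R ^ 2 * fro (S.Z P ℓ) ^ 2 := by simp [mul_assoc]
      _ ≤ _ := by
          refine mul_le_mul_of_nonneg_left ?_ (by positivity)
          exact pow_le_pow_left₀ (fro_nonneg _) hZ 2
  · have h1 : ∀ s j, |(S.WHatMat ℓ N ω - S.WMat P ℓ) s j| ≤ η / Real.sqrt ℓ * R := by
      rintro ⟨q, p⟩ j
      rw [Matrix.sub_apply, hW]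
      change |S.meanHat N ω j.rev p * S.ν j.rev q - _| ≤ _
      rw [← sub_mul, abs_mul]
      exact mul_le_mul (hω.mean _ j.rev.2.le p) (hν j q) (abs_nonneg _) (by positivity)
    refine (fro_le_of_forall_abs_le (by positivity) h1).trans ?_
    have e : Real.sqrt ℓ * (η / Real.sqrt ℓ * R) = R * η := by field_simp
    simp only [Fintype.card_prod, Fintype.card_fin, e, Nat.cast_mul, add_mul]
    rw [← mul_assoc]
    exact le_add_of_nonneg_left (by positivity)

/-- The deterministic half: closeness passes through the regression for `[A B]`, the nominal part,
and the regression for the covariances, at exact data that return the true values. -/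
theorem exists_covError_le (n m : ℕ) (R : ℝ) : ∃ K : ℝ, 1 ≤ K ∧ ∀ (ℓ N : ℕ) (Ω : Type v)
      [MeasurableSpace Ω] (P : Measure Ω) [IsProbabilityMeasure P] (S : System Ω n m)
      (cX cU cA cB : ℝ), 1 ≤ N → 0 < ℓ → S.SizeAtMost P ℓ cX cU cA cB R →
      S.SamplingAssumptions P ℓ N → S.BoundednessAssumptions P ℓ N cX cU cA cB →
      ∀ (η : ℝ) (ω : Ω), 0 ≤ η → η ≤ K⁻¹ → S.CloseMoments P ℓ N (η / Real.sqrt ℓ) ω →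
      S.covError P ℓ N ω ≤ K * η := by
  set yc := Real.sqrt (Fintype.card (Fin n)) * (R + 1)
  set zc := Real.sqrt (Fintype.card (Fin n ⊕ Fin m)) * (R + 1)
  set dc := Real.sqrt (Fintype.card (SymIdx n ⊕ SymIdx m)) * (R + 1)
  set wc := Real.sqrt m * R * (Real.sqrt (n + m) * (R + 1)) + Real.sqrt (m * n) * R
  obtain ⟨K₁, hK₁, H₁⟩ := exists_near_leastSquares (Fin n) (Fin n ⊕ Fin m) yc zc
    (Real.sqrt (Fintype.card (Fin n ⊕ Fin m)) * R)
  obtain ⟨K₂, H₂⟩ := exists_near_nominalMat n m K₁ dc wc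
  -- The first term covers the size of `C`, the bracket the distance: next-step moments plus nominal
  -- part.
  set cc := Real.sqrt (Fintype.card (SymIdx n)) * R +
    (Real.sqrt (Fintype.card (SymIdx n)) + K₂) with hcc
  obtain ⟨K₃, hK₃, H₃⟩ := exists_near_leastSquares (SymIdx n) (SymIdx n ⊕ SymIdx m) cc dc
    (Real.sqrt (Fintype.card (SymIdx n ⊕ SymIdx m)) * R)
  refine ⟨max K₁ K₃, hK₁.trans (le_max_left _ _), ?_⟩
  intro ℓ N Ω _ P _ S cX cU cA cB hN hℓ hR h hb η ω hη hηK hω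
  have hηK₁ : η ≤ K₁⁻¹ := hηK.trans (inv_anti₀ (by positivity) (le_max_left _ _))
  have hηK₃ : η ≤ K₃⁻¹ := hηK.trans (inv_anti₀ (by positivity) (le_max_right _ _))
  have hη1 : η ≤ 1 := hηK₁.trans (inv_le_one_of_one_le₀ hK₁)
  have hR0 : 0 ≤ R := (norm_nonneg _).trans hR.A_le
  have hℓ' : 0 < Real.sqrt ℓ := Real.sqrt_pos.2 (by exact_mod_cast hℓ)
  have hτ : 0 ≤ η / Real.sqrt ℓ := by positivity
  have hY : Near η yc (S.YHat ℓ N ω) (S.Y P ℓ) :=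
    Near.of_entries hℓ hη hR.Y_le fun i j => hω.mean _ (Nat.succ_le_of_lt j.rev.2) i
  have hZ : Near η zc (S.ZHat ℓ N ω) (S.Z P ℓ) := by
    refine Near.of_entries hℓ hη hR.Z_le ?_
    rintro (i | i) j
    · exact hω.mean _ j.rev.2.le i
    · simpa [ZHat, Z] using hτ
  have hD : Near η dc (S.DHat ℓ N ω) (S.D P ℓ) := by
    refine Near.of_entries hℓ hη hR.D_le ?_
    rintro (i | i) j
    · exact hω.second _ j.rev.2.le i
    · simpa [DHat, D] using hτ
  have hAB : Near η K₁ (S.ABHat ℓ N ω) (fromCols S.A S.B) := by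
    have := H₁ ℓ η _ _ _ _ hη hηK₁ hY hZ h.Z_inv
      ((fro_le_sqrt_card_mul_l2_opNorm _).trans (by gcongr; exact hR.Z_inv_le))
    rwa [mul_transpose_mul_inv_of_eq (Y_eq h hb hN) h.Z_inv] at this
  have hA : Near η K₁ (S.ABHat ℓ N ω).toCols₁ S.A := by
    have := hAB.submatrix (f := id) (g := Sum.inl) Function.injective_id Sum.inl_injective
    exact this
  have hB : Near η K₁ (S.ABHat ℓ N ω).toCols₂ S.B := by
    have := hAB.submatrix (f := id) (g := Sum.inr) Function.injective_id Sum.inr_injective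
    exact this
  have hX : Near η dc (S.DHat ℓ N ω).toRows₁ (S.D P ℓ).toRows₁ :=
    hD.submatrix (f := Sum.inl) (g := id) Sum.inl_injective Function.injective_id
  have hU : Near η dc (S.DHat ℓ N ω).toRows₂ (S.D P ℓ).toRows₂ :=
    hD.submatrix (f := Sum.inr) (g := id) Sum.inr_injective Function.injective_id
  have hW := near_WHatMat h hb hN hℓ hR hη hω
  have hW' := hW.submatrix (f := Prod.swap) (g := id) Prod.swap_injective Function.injective_id
  have hnom := H₂ ℓ η _ _ _ _ _ _ _ _ _ _ _ _ hη hη1 hA hB hX hW hW' hU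
  have hC : Near η cc (S.CHat ℓ N ω) (S.C P ℓ) := by
    constructor
    · refine (fro_le_sqrt_card_mul_l2_opNorm _).trans ?_
      rw [hcc]
      exact le_add_of_le_of_nonneg (mul_le_mul_of_nonneg_left hR.C_le (by positivity))
        (add_nonneg (by positivity) hnom.nonneg)
    · have h1 : fro (S.XNextHat ℓ N ω - S.XNext P ℓ) ≤
          Real.sqrt (Fintype.card (SymIdx n)) * η := by
        refine (fro_le_of_forall_abs_le hτ fun s j =>
          hω.second _ (Nat.succ_le_of_lt j.rev.2) s).trans ?_
        rw [Fintype.card_fin, mul_div_cancel₀ _ hℓ'.ne']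
      rw [C_eq_sub h hb hN, CHat_eq_sub, sub_sub_sub_comm, sub_eq_add_neg]
      refine (fro_add_le _ _).trans ?_
      rw [fro_neg]
      refine (add_le_add h1 hnom.dist).trans ?_
      rw [← add_mul]
      refine mul_le_mul_of_nonneg_right ?_ hη
      rw [hcc]
      exact le_add_of_nonneg_left (by positivity)
  have hcov := H₃ ℓ η _ _ _ _ hη hηK₃ hC hD h.D_inv
    ((fro_le_sqrt_card_mul_l2_opNorm _).trans (by gcongr; exact hR.D_inv_le))
  rw [mul_transpose_mul_inv_of_eq (C_eq h hb hN) h.D_inv] at hcov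
  exact (l2_opNorm_le_fro _).trans (hcov.dist.trans (by gcongr; exact le_max_right _ _))

theorem meanHat_apply {Ω : Type*} {n m : ℕ} (S : System Ω n m) (N : ℕ) (ω : Ω) (t : ℕ)
    (i : Fin n) : S.meanHat N ω t i = (N : ℝ)⁻¹ * ∑ k ∈ Finset.range N, S.state k t ω i := by
  simp [meanHat]

theorem XtilHat_apply {Ω : Type*} {n m : ℕ} (S : System Ω n m) (N : ℕ) (ω : Ω) (t : ℕ)
    (s : SymIdx n) : S.XtilHat N ω t s =
      (N : ℝ)⁻¹ * ∑ k ∈ Finset.range N, S.state k t ω s.1.2 * S.state k t ω s.1.1 := by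
  rw [XtilHat, elimMatrix_mulVec]
  simp [vec, Matrix.sum_apply, vecMulVec_apply]

/-! ### Concentration of the empirical moments and the tail bound. -/

section concentration

variable {Ω : Type*} {n m : ℕ} {S : System Ω n m} {N ℓ : ℕ}
variable [MeasurableSpace Ω] {P : Measure Ω} [IsProbabilityMeasure P] {cX cU cA cB R : ℝ}

/-- Hoeffding for each average and a union bound over times and coordinates. The common bound `(R +
1) ^ 2` dominates both `R` for states and `R ^ 2` for their products. -/
theorem measure_not_closeMoments_le (h : S.SamplingAssumptions P ℓ N)
    (hb : S.BoundednessAssumptions P ℓ N cX cU cA cB) (hN : 1 ≤ N) (hR0 : 0 ≤ R)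
    (hR : S.reachRadius ℓ cX cU cA cB ≤ R) {τ : ℝ} (hτ : 0 ≤ τ) :
    P.real {ω | ¬ S.CloseMoments P ℓ N τ ω} ≤
      (ℓ + 1) * ((n + Fintype.card (SymIdx n)) *
        (2 * Real.exp (-(N * τ ^ 2 / (2 * ((R + 1) ^ 2) ^ 2))))) := by
  set p := 2 * Real.exp (-(N * τ ^ 2 / (2 * ((R + 1) ^ 2) ^ 2))) with hp
  have hstate : ∀ k < N, ∀ t ≤ ℓ, ∀ i,
      Measurable[⨆ s ∈ {s : Source N ℓ | s.rollout = k}, S.sourceAlg s]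
        (fun ω => S.state k t ω i) := fun k hk t ht i =>
    (S.measurable_state hk t ht i).mono (biSup_mono fun s hs => hs.1) le_rfl
  have hmean : ∀ t ≤ ℓ, ∀ i, P.real {ω | τ ≤ |S.meanHat N ω t i - S.mean P t i|} ≤ p := by
    intro t ht i
    simp only [meanHat_apply]
    refine measure_abs_average_sub_ge_le h.sourceAlg_le_ambient h.iIndep_sourceAlg
      Source.rollout hN (X := fun k ω => S.state k t ω i) (fun k hk => hstate k hk t ht i)
      (fun k hk => ?_) (fun k hk => integral_state_eq_mean h hb hk t ht i) hτ
    filter_upwards [S.ae_abs_state_le hb hR hk ht i] with ω hω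
    nlinarith
  have hsecond : ∀ t ≤ ℓ, ∀ s, P.real {ω | τ ≤ |S.XtilHat N ω t s - S.Xtil P t s|} ≤ p := by
    intro t ht s
    simp only [XtilHat_apply]
    refine measure_abs_average_sub_ge_le h.sourceAlg_le_ambient h.iIndep_sourceAlg
      Source.rollout hN (X := fun k ω => S.state k t ω s.1.2 * S.state k t ω s.1.1)
      (fun k hk => (hstate k hk t ht _).mul (hstate k hk t ht _)) (fun k hk => ?_)
      (fun k hk => ?_) hτ
    · filter_upwards [S.ae_abs_state_le hb hR hk ht s.1.1,
        S.ae_abs_state_le hb hR hk ht s.1.2] with ω h1 h2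
      rw [abs_mul]
      nlinarith [mul_le_mul h1 h2 (abs_nonneg _) hR0]
    · rw [integral_state_mul_state_eq h hb hk t ht, Xtil, elimMatrix_mulVec]
      rfl
  calc P.real {ω | ¬ S.CloseMoments P ℓ N τ ω}
      ≤ P.real (⋃ t ∈ Finset.range (ℓ + 1),
          ((⋃ i ∈ Finset.univ, {ω | τ ≤ |S.meanHat N ω t i - S.mean P t i|}) ∪
          ⋃ s ∈ Finset.univ, {ω | τ ≤ |S.XtilHat N ω t s - S.Xtil P t s|})) := by
        refine measureReal_mono (fun ω hω => ?_) (measure_ne_top _ _)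
        by_contra hcon
        refine hω ⟨fun t ht i => ?_, fun t ht s => ?_⟩ <;> by_contra! hlt <;> apply hcon <;>
          simp only [Set.mem_iUnion, Set.mem_union, Finset.mem_range]
        · exact ⟨t, Nat.lt_succ_of_le ht, Or.inl ⟨i, Finset.mem_univ _, hlt.le⟩⟩
        · exact ⟨t, Nat.lt_succ_of_le ht, Or.inr ⟨s, Finset.mem_univ _, hlt.le⟩⟩
    _ ≤ ∑ t ∈ Finset.range (ℓ + 1), (n + Fintype.card (SymIdx n)) * p := by
        refine (measureReal_biUnion_finset_le _ _).trans (Finset.sum_le_sum fun t ht => ?_)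
        have ht' : t ≤ ℓ := Nat.lt_succ_iff.1 (Finset.mem_range.1 ht)
        refine (measureReal_union_le _ _).trans ?_
        rw [add_mul]
        refine add_le_add ?_ ?_
        · refine (measureReal_biUnion_finset_le _ _).trans ?_
          simpa using Finset.sum_le_sum fun i (_ : i ∈ Finset.univ) => hmean t ht' i
        · refine (measureReal_biUnion_finset_le _ _).trans ?_
          simpa using
            Finset.sum_le_sum fun s (_ : s ∈ Finset.univ) => hsecond t ht' s
    _ = _ := by simp

end concentration

/-- Used to absorb `ℓ + 1` into `2 ℓ` and to keep `log (ℓ / δ)` away from zero. -/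
theorem two_le_of_length {n m ℓ : ℕ} (hm : 1 ≤ m) (hmn : m ≤ n)
    (h : n * (n + 1) + m * (m + 1) ≤ 2 * ℓ) : 2 ≤ ℓ := by nlinarith

/-- Exponential tail bound for the estimation error. -/
theorem exists_measure_covError_ge_le (n m : ℕ) (hm : 1 ≤ m) (hmn : m ≤ n) (R : ℝ) :
    ∃ K : ℝ, 1 ≤ K ∧ ∀ (ℓ N : ℕ) (Ω : Type v) [MeasurableSpace Ω] (P : Measure Ω)
      [IsProbabilityMeasure P] (S : System Ω n m) (cX cU cA cB : ℝ), 1 ≤ N →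
      S.SizeAtMost P ℓ cX cU cA cB R → S.SamplingAssumptions P ℓ N →
      S.BoundednessAssumptions P ℓ N cX cU cA cB → ∀ ε : ℝ, 0 < ε → ε ≤ K⁻¹ →
      P.real {ω | ε ≤ S.covError P ℓ N ω} ≤ K * ℓ * Real.exp (-(N * ε ^ 2 / (K * ℓ))) := by
  obtain ⟨K₁, hK₁, H⟩ := exists_covError_le.{v} n m R
  set q : ℝ := n + Fintype.card (SymIdx n)
  set b : ℝ := (R + 1) ^ 2
  have hq : 0 ≤ q := by positivity
  -- `4 q` absorbs the prefactor `2 (ℓ + 1) q`, and `8 K₁² b²` comes from Hoeffding's exponent at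
  -- accuracy `ε / (2 K₁ √ℓ)`.
  set K := max 1 (max (4 * q) (8 * K₁ ^ 2 * b ^ 2))
  have hK : 1 ≤ K := le_max_left _ _
  have hKq : 4 * q ≤ K := (le_max_left _ _).trans (le_max_right _ _)
  have hKb : 8 * K₁ ^ 2 * b ^ 2 ≤ K := (le_max_right _ _).trans (le_max_right _ _)
  refine ⟨K, hK, ?_⟩
  intro ℓ N Ω _ P _ S cX cU cA cB hN hR h hb ε hε hεK
  have hℓ : 2 ≤ ℓ := two_le_of_length hm hmn h.length
  have hℓ' : (2 : ℝ) ≤ ℓ := by exact_mod_cast hℓ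
  have hR0 : 0 ≤ R := (norm_nonneg _).trans hR.A_le
  have hb0 : 0 < b := by positivity
  have hε1 : ε ≤ 1 := hεK.trans (inv_le_one_of_one_le₀ hK)
  -- The factor `2` makes the error at most `ε / 2` on the good event, strictly below `ε`.
  have hη : 0 ≤ ε / (2 * K₁) := by positivity
  have hη1 : ε / (2 * K₁) ≤ K₁⁻¹ := by
    rw [div_le_iff₀ (by positivity)]
    have : K₁⁻¹ * (2 * K₁) = 2 := by field_simp
    linarith
  calc P.real {ω | ε ≤ S.covError P ℓ N ω}
      ≤ P.real {ω | ¬ S.CloseMoments P ℓ N (ε / (2 * K₁) / Real.sqrt ℓ) ω} := by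
        refine measureReal_mono fun ω hω hclose => ?_
        have h1 := H ℓ N Ω P S cX cU cA cB hN (by omega) hR h hb _ ω hη hη1 hclose
        have h2 : K₁ * (ε / (2 * K₁)) = ε / 2 := by field_simp
        have h3 : ε ≤ S.covError P ℓ N ω := hω
        linarith
    _ ≤ (ℓ + 1) * (q * (2 * Real.exp (-(N * (ε / (2 * K₁) / Real.sqrt ℓ) ^ 2 /
          (2 * b ^ 2))))) :=
        measure_not_closeMoments_le h hb hN hR0 hR.reach_le (by positivity)
    _ = (2 * (ℓ + 1) * q) * Real.exp (-(N * ε ^ 2 / (8 * K₁ ^ 2 * b ^ 2 * ℓ))) := by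
        rw [div_pow, div_pow, Real.sq_sqrt (by positivity)]
        have : N * (ε ^ 2 / (2 * K₁) ^ 2 / ℓ) / (2 * b ^ 2) =
            N * ε ^ 2 / (8 * K₁ ^ 2 * b ^ 2 * ℓ) := by
          field_simp
          ring
        rw [this]
        ring
    _ ≤ K * ℓ * Real.exp (-(N * ε ^ 2 / (K * ℓ))) := by
        refine mul_le_mul ?_ (Real.exp_le_exp.2 ?_) (Real.exp_nonneg _) (by positivity)
        · nlinarith
        · gcongr

/-- The two events cover the space, and subadditivity holds for arbitrary sets, so measurability of
the error is never needed. -/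
theorem one_sub_le_measure_le {Ω : Type*} [MeasurableSpace Ω] {P : Measure Ω}
    [IsProbabilityMeasure P] {f : Ω → ℝ} {ε δ : ℝ} (h : P.real {ω | ε ≤ f ω} ≤ δ) :
    1 - δ ≤ P.real {ω | f ω ≤ ε} := by
  have h1 : P.real Set.univ ≤ P.real ({ω | f ω ≤ ε} ∪ {ω | ε ≤ f ω}) :=
    measureReal_mono fun ω _ => le_total (f ω) ε
  have h2 := measureReal_union_le (μ := P) {ω | f ω ≤ ε} {ω | ε ≤ f ω}
  rw [probReal_univ] at h1
  linarith

/-- Every real function on a probability space, measurable or not, is bounded in probability. -/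
theorem exists_one_sub_le_measure_le {Ω : Type*} [MeasurableSpace Ω] (P : Measure Ω)
    [IsProbabilityMeasure P] (f : Ω → ℝ) {δ : ℝ} (hδ : 0 < δ) :
    ∃ c : ℝ, 0 < c ∧ 1 - δ ≤ P.real {ω | f ω ≤ c} := by
  have hmono : Monotone fun k : ℕ => {ω | f ω ≤ k} := fun i j hij ω hω =>
    le_trans (b := (i : ℝ)) hω (by exact_mod_cast hij)
  have hU : ⋃ k : ℕ, {ω | f ω ≤ k} = Set.univ :=
    Set.eq_univ_of_forall fun ω => Set.mem_iUnion.2 (exists_nat_ge (f ω))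
  -- Continuity from below holds for increasing sets without measurability.
  have ht := tendsto_measure_iUnion_atTop (μ := P) hmono
  rw [hU] at ht
  have ht' : Filter.Tendsto (fun k : ℕ => P.real {ω | f ω ≤ k}) Filter.atTop (nhds 1) := by
    have := (ENNReal.tendsto_toReal (measure_ne_top P Set.univ)).comp ht
    rw [measure_univ, ENNReal.toReal_one] at this
    exact this
  obtain ⟨k, hk, hk1⟩ := ((ht'.eventually (lt_mem_nhds (show 1 - δ < 1 by linarith))).and
    (Filter.eventually_ge_atTop 1)).exists
  exact ⟨k, by exact_mod_cast hk1, hk.le⟩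

end System

end MultNoise

/-! ### From the tail bound to confidence bounds. -/

theorem mainTheorem3 (n m : ℕ) (hm : 1 ≤ m) (hmn : m ≤ n) (R : ℝ) :
    ∃ K : ℝ, 0 < K ∧
      ∀ (ℓ : ℕ) (Ω : Type*) [MeasurableSpace Ω] (P : Measure Ω) [IsProbabilityMeasure P]
        (S : MultNoise.System Ω n m) (cX cU cA cB : ℝ),
        S.SizeAtMost P ℓ cX cU cA cB R →
        -- finite-sample bounds for `N` rollouts
        (∀ N : ℕ, 1 ≤ N → S.SamplingAssumptions P ℓ N →
          S.BoundednessAssumptions P ℓ N cX cU cA cB →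
          (∀ δ : ℝ, 0 < δ → δ < 1 → K * (ℓ * Real.log (ℓ / δ)) ≤ N →
            1 - δ ≤ P.real {ω | S.covError P ℓ N ω ≤
              K * Real.sqrt (ℓ * Real.log (ℓ / δ) / N)}) ∧
          (∀ ε : ℝ, 0 < ε → ε ≤ K⁻¹ →
            P.real {ω | ε ≤ S.covError P ℓ N ω} ≤
              K * ℓ * Real.exp (-(N * ε ^ 2 / (K * ℓ))))) ∧
        -- for an infinite sequence of rollouts and a fixed `δ`, the rate holds for all `N`
        ((∀ N : ℕ, 1 ≤ N → S.SamplingAssumptions P ℓ N ∧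
          S.BoundednessAssumptions P ℓ N cX cU cA cB) →
          ∀ δ : ℝ, 0 < δ → δ < 1 → ∃ C : ℝ, 0 < C ∧ ∀ N : ℕ, 1 ≤ N →
            1 - δ ≤ P.real {ω | S.covError P ℓ N ω ≤
              C * Real.sqrt (ℓ * Real.log (ℓ / δ) / N)}) := by
  obtain ⟨K₂, hK₂, H⟩ := MultNoise.System.exists_measure_covError_ge_le n m hm hmn R
  have hK₂3 : K₂ ≤ K₂ ^ 4 := le_self_pow₀ hK₂ (by norm_num)
  -- `N ≥ 4 K₂⁴ ℓ L` is exactly the condition for `ε = 2 K₂ √(ℓ L / N)` to be at most `1 / K₂`; the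
  -- constant also dominates `K₂` and `2 K₂`.
  refine ⟨4 * K₂ ^ 4, by positivity, ?_⟩
  intro ℓ Ω _ P _ S cX cU cA cB hR
  have hlog : 2 ≤ ℓ → ∀ δ : ℝ, 0 < δ → δ < 1 → 2 / 3 ≤ Real.log (ℓ / δ) := by
    intro hℓ δ hδ hδ1
    have hℓ' : (2 : ℝ) ≤ ℓ := by exact_mod_cast hℓ
    have h2 : (2 : ℝ) ≤ ℓ / δ := by
      rw [le_div_iff₀ hδ]
      linarith
    have := Real.log_le_log (by norm_num) h2
    linarith [Real.log_two_gt_d9]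
  have hdelta : ∀ N : ℕ, 1 ≤ N → S.SamplingAssumptions P ℓ N →
      S.BoundednessAssumptions P ℓ N cX cU cA cB →
      ∀ δ : ℝ, 0 < δ → δ < 1 → 4 * K₂ ^ 4 * (ℓ * Real.log (ℓ / δ)) ≤ N →
        1 - δ ≤ P.real {ω | S.covError P ℓ N ω ≤
          4 * K₂ ^ 4 * Real.sqrt (ℓ * Real.log (ℓ / δ) / N)} := by
    intro N hN h hb δ hδ hδ1 hNK
    have hℓ := MultNoise.System.two_le_of_length hm hmn h.length
    have hℓ' : (2 : ℝ) ≤ ℓ := by exact_mod_cast hℓ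
    have hN' : (0 : ℝ) < N := by exact_mod_cast hN
    have hL := hlog hℓ δ hδ hδ1
    set L := Real.log (ℓ / δ) with hLdef
    have hx : 0 < ℓ * L / N := by positivity
    set ε := 2 * K₂ * Real.sqrt (ℓ * L / N) with hε
    have hε2 : ε ^ 2 = 4 * K₂ ^ 2 * (ℓ * L / N) := by
      rw [hε, mul_pow, Real.sq_sqrt hx.le]
      ring
    have hεK : ε ≤ K₂⁻¹ := by
      refine le_of_sq_le_sq ?_ (by positivity)
      rw [hε2, inv_pow, ← mul_div_assoc, div_le_iff₀ hN']
      have h1 : 4 * K₂ ^ 4 * (ℓ * L) * (K₂ ^ 2)⁻¹ ≤ N * (K₂ ^ 2)⁻¹ := by gcongr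
      have h2 : 4 * K₂ ^ 4 * (ℓ * L) * (K₂ ^ 2)⁻¹ = 4 * K₂ ^ 2 * (ℓ * L) := by field_simp
      linarith
    have hbad : P.real {ω | ε ≤ S.covError P ℓ N ω} ≤ δ := by
      refine (H ℓ N Ω P S cX cU cA cB hN hR h hb ε (by positivity) hεK).trans ?_
      have e1 : N * ε ^ 2 / (K₂ * ℓ) = 4 * K₂ * L := by
        rw [hε2]
        field_simp
      have e2 : Real.exp (-L) = δ / ℓ := by
        rw [Real.exp_neg, hLdef, Real.exp_log (by positivity), inv_div]
      -- The exponent is split, using `K₂ ≥ 1` and `L ≥ 2 / 3`: `exp (-L) = δ / ℓ` cancels the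
      -- factor `ℓ`, and `exp (-K₂)` absorbs the factor `K₂`.
      have e3 : -(4 * K₂ * L) ≤ -L + -K₂ := by nlinarith
      have e4 : K₂ * Real.exp (-K₂) ≤ 1 := by
        rw [Real.exp_neg, mul_inv_le_iff₀ (Real.exp_pos _)]
        linarith [Real.add_one_le_exp K₂]
      rw [e1]
      calc K₂ * ℓ * Real.exp (-(4 * K₂ * L)) ≤ K₂ * ℓ * Real.exp (-L + -K₂) := by gcongr
        _ = K₂ * Real.exp (-K₂) * δ := by
            rw [Real.exp_add, e2]
            field_simp
        _ ≤ 1 * δ := by gcongr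
        _ = δ := one_mul δ
    refine (MultNoise.System.one_sub_le_measure_le hbad).trans (measureReal_mono fun ω hω => ?_)
    refine le_trans (b := ε) hω ?_
    rw [hε]
    gcongr
    linarith
  refine ⟨fun N hN h hb => ⟨hdelta N hN h hb, fun ε hε hεK => ?_⟩, ?_⟩
  · refine (H ℓ N Ω P S cX cU cA cB hN hR h hb ε hε
      (hεK.trans (inv_anti₀ (by positivity) (by linarith)))).trans ?_
    have hℓ := MultNoise.System.two_le_of_length hm hmn h.length
    have hℓ' : (2 : ℝ) ≤ ℓ := by exact_mod_cast hℓ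
    have hK₂4 : K₂ ≤ 4 * K₂ ^ 4 := by linarith
    gcongr
  · intro hall δ hδ hδ1
    have hℓ := MultNoise.System.two_le_of_length hm hmn (hall 1 le_rfl).1.length
    have hℓ' : (2 : ℝ) ≤ ℓ := by exact_mod_cast hℓ
    have hL := hlog hℓ δ hδ hδ1
    set L := Real.log (ℓ / δ)
    choose c hc0 hc using fun N =>
      MultNoise.System.exists_one_sub_le_measure_le P (S.covError P ℓ N) hδ
    set N₀ := ⌈4 * K₂ ^ 4 * (ℓ * L)⌉₊
    have hterm : ∀ N ∈ Finset.range N₀, 0 ≤ c N / Real.sqrt (ℓ * L / N) := fun N _ =>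
      div_nonneg (hc0 N).le (Real.sqrt_nonneg _)
    -- Each `N` below the threshold `N₀` contributes the ratio that makes its own bound `c N` fit
    -- the rate. The term `N = 0` is `0` by division by zero.
    refine ⟨4 * K₂ ^ 4 + ∑ N ∈ Finset.range N₀, c N / Real.sqrt (ℓ * L / N),
      add_pos_of_pos_of_nonneg (by positivity) (Finset.sum_nonneg hterm), ?_⟩
    intro N hN
    have hN' : (0 : ℝ) < N := by exact_mod_cast hN
    rcases lt_or_ge N N₀ with hlt | hge
    · refine (hc N).trans (measureReal_mono fun ω hω => le_trans (b := c N) hω ?_)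
      have hs : 0 < Real.sqrt (ℓ * L / N) := Real.sqrt_pos.2 (by positivity)
      rw [← div_le_iff₀ hs]
      refine le_add_of_nonneg_of_le (by positivity) ?_
      exact Finset.single_le_sum hterm (Finset.mem_range.2 hlt)
    · refine (hdelta N hN (hall N hN).1 (hall N hN).2 δ hδ hδ1
        ((Nat.le_ceil _).trans (by exact_mod_cast hge))).trans
        (measureReal_mono fun ω hω => le_trans
          (b := 4 * K₂ ^ 4 * Real.sqrt (ℓ * L / N)) hω ?_)
      refine mul_le_mul_of_nonneg_right ?_ (Real.sqrt_nonneg _)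
      exact le_add_of_nonneg_right (Finset.sum_nonneg hterm)
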